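/- Let $\alpha\in[1,2)$, $T>0$, $f_0\in L^2(0,1)$ and $u\in H^1(0,T)$ (all functions real-valued). Consider the boundary-controlled degenerate parabolic system $$\begin{cases}\partial_t f-\partial_x(x^\alpha\partial_x f)=0, & (t,x)\in(0,T)\times(0,1),\\ (x^\alpha\partial_x f)(t,x)|_{x=0}=0,\quad f(t,1)=u(t), & t\in(0,T),\\ f(0,x)=f_0(x), & x\in(0,1).\end{cases}$$ A weak solution is a function $f\in C^0([0,T];L^2(0,1))$ such that for every $t'\in[0,T]$ and every $\psi\in C^1([0,t'];L^2(0,1))\cap C^0([0,t'];H^2(0,1))$ with $(x^\alpha\partial_x\psi)(t,x)|_{x=0}=\psi(t,1)=0$ for all $t\in[0,t']$, $$\int_0^{t'}\!\int_0^1 f\,\bigl(\partial_t\psi+\partial_x(x^\alpha\partial_x\psi)\bigr)\,dx\,dt=\int_0^1 f(t',x)\psi(t',x)\,dx-\int_0^1 f_0(x)\psi(0,x)\,dx+\int_0^{t'}u(t)\,\partial_x\psi(t,1)\,dt.$$ Then the system has exactly one weak solution. -/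

import Mathlib

open MeasureTheory Set Filter Topology
open scoped ContDiff

noncomputable section

namespace DegenerateParabolic

/-- `g` is the weak (distributional) derivative of `f` on the interval `(a, b)`. -/
def HasWeakDeriv (a b : ℝ) (f g : ℝ → ℝ) : Prop :=
  LocallyIntegrableOn f (Ioo a b) ∧ LocallyIntegrableOn g (Ioo a b) ∧
    ∀ φ : ℝ → ℝ, ContDiff ℝ ∞ φ → HasCompactSupport φ → tsupport φ ⊆ Ioo a b →
      ∫ x in Ioo a b, f x * deriv φ x = -∫ x in Ioo a b, g x * φ x

open Classical in
/-- The weak derivative of `f` on `(a, b)`; it is determined up to a null set, and a version is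
chosen (it is `0` if `f` has no weak derivative). -/
def weakDeriv (a b : ℝ) (f : ℝ → ℝ) : ℝ → ℝ :=
  if h : ∃ g, HasWeakDeriv a b f g then h.choose else 0

/-- `f` belongs to the Sobolev space `H¹(a, b)`. -/
def MemH1 (a b : ℝ) (f : ℝ → ℝ) : Prop :=
  MemLp f 2 (volume.restrict (Ioo a b)) ∧
    ∃ g : ℝ → ℝ, MemLp g 2 (volume.restrict (Ioo a b)) ∧ HasWeakDeriv a b f g

/-- The real Hilbert space `L²(0, 1)`. -/
abbrev L2 : Type := Lp ℝ 2 (volume.restrict (Ioo (0 : ℝ) 1))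

lemma L2.locallyIntegrableOn (f : L2) : LocallyIntegrableOn (f : ℝ → ℝ) (Ioo (0 : ℝ) 1) := by
  have h : IntegrableOn (f : ℝ → ℝ) (Ioo (0 : ℝ) 1) volume :=
    (Lp.memLp f).integrable (by norm_num)
  exact h.locallyIntegrableOn

lemma L2.integrable_mul (f : L2) {φ : ℝ → ℝ} (hφ : Continuous φ) (hc : HasCompactSupport φ) :
    Integrable (fun x => f x * φ x) (volume.restrict (Ioo (0 : ℝ) 1)) := by
  have h : MemLp φ 2 (volume.restrict (Ioo (0 : ℝ) 1)) := hφ.memLp_of_hasCompactSupport hc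
  exact (Lp.memLp f).integrable_mul h

lemma HasWeakDeriv.add_L2 {f g f' g' : L2} (h : HasWeakDeriv 0 1 f g)
    (h' : HasWeakDeriv 0 1 f' g') : HasWeakDeriv 0 1 (f + f' : L2) (g + g' : L2) := by
  refine ⟨L2.locallyIntegrableOn _, L2.locallyIntegrableOn _, fun φ hφ hc hs => ?_⟩
  have hd : Continuous (deriv φ) := hφ.continuous_deriv (by simp)
  have e₁ : ∫ x in Ioo (0 : ℝ) 1, (f + f' : L2) x * deriv φ x
      = ∫ x in Ioo (0 : ℝ) 1, (f x * deriv φ x + f' x * deriv φ x) := by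
    refine integral_congr_ae ?_
    filter_upwards [Lp.coeFn_add f f'] with x hx
    rw [hx, Pi.add_apply, add_mul]
  have e₂ : ∫ x in Ioo (0 : ℝ) 1, (g + g' : L2) x * φ x
      = ∫ x in Ioo (0 : ℝ) 1, (g x * φ x + g' x * φ x) := by
    refine integral_congr_ae ?_
    filter_upwards [Lp.coeFn_add g g'] with x hx
    rw [hx, Pi.add_apply, add_mul]
  rw [e₁, e₂, integral_add (L2.integrable_mul f hd hc.deriv) (L2.integrable_mul f' hd hc.deriv),
    integral_add (L2.integrable_mul g hφ.continuous hc) (L2.integrable_mul g' hφ.continuous hc),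
    h.2.2 φ hφ hc hs, h'.2.2 φ hφ hc hs]
  ring

lemma HasWeakDeriv.smul_L2 (c : ℝ) {f g : L2} (h : HasWeakDeriv 0 1 f g) :
    HasWeakDeriv 0 1 (c • f : L2) (c • g : L2) := by
  refine ⟨L2.locallyIntegrableOn _, L2.locallyIntegrableOn _, fun φ hφ hc hs => ?_⟩
  have e₁ : ∫ x in Ioo (0 : ℝ) 1, (c • f : L2) x * deriv φ x
      = ∫ x in Ioo (0 : ℝ) 1, c * (f x * deriv φ x) := by
    refine integral_congr_ae ?_
    filter_upwards [Lp.coeFn_smul c f] with x hx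
    rw [hx, Pi.smul_apply, smul_eq_mul, mul_assoc]
  have e₂ : ∫ x in Ioo (0 : ℝ) 1, (c • g : L2) x * φ x
      = ∫ x in Ioo (0 : ℝ) 1, c * (g x * φ x) := by
    refine integral_congr_ae ?_
    filter_upwards [Lp.coeFn_smul c g] with x hx
    rw [hx, Pi.smul_apply, smul_eq_mul, mul_assoc]
  rw [e₁, e₂, integral_const_mul, integral_const_mul, h.2.2 φ hφ hc hs]
  ring

lemma HasWeakDeriv.zero_L2 : HasWeakDeriv 0 1 (0 : L2) (0 : L2) := by
  refine ⟨L2.locallyIntegrableOn _, L2.locallyIntegrableOn _, fun φ _ _ _ => ?_⟩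
  have e (k : ℝ → ℝ) : ∫ x in Ioo (0 : ℝ) 1, (0 : L2) x * k x = 0 := by
    refine integral_eq_zero_of_ae ?_
    filter_upwards [Lp.coeFn_zero ℝ 2 (volume.restrict (Ioo (0 : ℝ) 1))] with x hx
    rw [hx]
    simp
  rw [e, e, neg_zero]

/-- The Sobolev space `H²(0, 1)`. A function `f` is represented by the triple `(f, f', f'')` of
its weak derivatives (the last two entries are determined by the first), so that the topology
induced by `L² × L² × L²` is that of the `H²` norm. -/
def H2 : Submodule ℝ (L2 × L2 × L2) where
  carrier := {p | HasWeakDeriv 0 1 p.1 p.2.1 ∧ HasWeakDeriv 0 1 p.2.1 p.2.2}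
  add_mem' h h' := ⟨h.1.add_L2 h'.1, h.2.add_L2 h'.2⟩
  zero_mem' := ⟨HasWeakDeriv.zero_L2, HasWeakDeriv.zero_L2⟩
  smul_mem' c _ h := ⟨h.1.smul_L2 c, h.2.smul_L2 c⟩

/-- The function underlying an element of `H²(0, 1)`. -/
def toL2 (p : H2) : L2 := p.1.1

/-- The first derivative of an element of `H²(0, 1)`. -/
def dx (p : H2) : L2 := p.1.2.1

open Classical in
/-- The continuous representative on `[0, 1]` of a function on `(0, 1)` given up to null sets
(junk value `0` if there is none; elements of `H¹(0, 1)` always have one). -/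
def contRep (f : ℝ → ℝ) : ℝ → ℝ :=
  if h : ∃ g : ℝ → ℝ, ContinuousOn g (Icc 0 1) ∧ f =ᵐ[volume.restrict (Ioo (0 : ℝ) 1)] g
  then h.choose else 0

/-- `ψ ∈ C¹([0,τ]; L²(0,1)) ∩ C⁰([0,τ]; H²(0,1))` with the boundary conditions
`(x^α ∂ₓψ)(t,x)|_{x=0} = ψ(t,1) = 0` for all `t ∈ [0,τ]`. -/
structure IsTestFunction (α τ : ℝ) (ψ : ℝ → H2) : Prop where
  contDiffOn : ContDiffOn ℝ 1 (fun t => toL2 (ψ t)) (Icc 0 τ)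
  continuousOn : ContinuousOn ψ (Icc 0 τ)
  flux_zero : ∀ t ∈ Icc 0 τ,
    Tendsto (fun x : ℝ => x ^ α * contRep (dx (ψ t)) x) (𝓝[>] 0) (𝓝 0)
  eq_zero : ∀ t ∈ Icc 0 τ, contRep (toL2 (ψ t)) 1 = 0

/-- `f` is a weak solution on `[0,T]` of `∂ₜf - ∂ₓ(x^α ∂ₓf) = 0` with `(x^α ∂ₓf)(t,0) = 0`,
`f(t,1) = u(t)` and `f(0,·) = f₀`. Only the values of `f` on `[0,T]` matter. -/
structure IsWeakSolution (α T : ℝ) (f₀ : L2) (u : ℝ → ℝ) (f : ℝ → L2) : Prop where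
  continuousOn : ContinuousOn f (Icc 0 T)
  integral_identity : ∀ τ ∈ Icc 0 T, ∀ ψ : ℝ → H2, IsTestFunction α τ ψ →
    ∫ t in (0 : ℝ)..τ, ∫ x in Ioo (0 : ℝ) 1,
        f t x * (derivWithin (fun s => toL2 (ψ s)) (Icc 0 τ) t x
          + weakDeriv 0 1 (fun y => y ^ α * dx (ψ t) y) x)
      = (∫ x in Ioo (0 : ℝ) 1, f τ x * toL2 (ψ τ) x)
        - (∫ x in Ioo (0 : ℝ) 1, f₀ x * toL2 (ψ 0) x)
        + ∫ t in (0 : ℝ)..τ, u t * contRep (dx (ψ t)) 1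

end DegenerateParabolic

end

/-!
The operator `-∂ₓ(x^α ∂ₓ)` with vanishing flux at `0` and vanishing value at `1` has the inverse
`K = S* S`, where `S f x = x ^ (-α/2) ∫₀ˣ f` is bounded on `L²(0, 1)` because `α < 2`; so `K` is a
bounded, positive and injective operator. Since `∂ₓψ(t, 1)` is the inner product of `∂ₓ(x^α ∂ₓψ)`
with the constant function `1`, and since `∂ₓ(x^α ∂ₓp)` can be prescribed densely in `L²(0, 1)`,
the weak formulation is equivalent to the integrated equation
`K f(t) = K f₀ + ∫₀ᵗ (u(s) 1 - f(s)) ds`, in which no unbounded operator occurs.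

Uniqueness: for the difference `f` of two solutions and `w(t) = ∫₀ᵗ f`, the quantity `⟪K w, w⟫` is
nonnegative, starts at `0`, and has derivative `-2 ‖w‖²`. Existence: the semigroup generated by
`-K⁻¹` is the limit of the exponentials of `-t (K + ε)⁻¹` as `ε → 0`, which are contractions and
converge uniformly in `t` on the dense range of `K²`. Duhamel's formula with `u = c + ∫ u'`
integrated by parts then only involves `u'`, the semigroup, and the bounded operator `K`.
-/

open scoped InnerProductSpace

namespace DegenerateParabolic

section RegularizedInverse

variable {H : Type*} [NormedAddCommGroup H] [InnerProductSpace ℝ H] {K : H →L[ℝ] H} {ε δ : ℝ}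

/-- The inverse `(K + ε)⁻¹`, a bounded approximation of the (unbounded) inverse of an injective
accretive operator `K`; the value is junk unless `K + ε` is invertible. -/
noncomputable def regularizedInverse (K : H →L[ℝ] H) (ε : ℝ) : H →L[ℝ] H :=
  Ring.inverse (K + ε • 1)

lemma commute_regularizedInverse (K : H →L[ℝ] H) (ε δ : ℝ) :
    Commute (regularizedInverse K ε) (regularizedInverse K δ) :=
  (((Commute.refl K).add_left ((Commute.one_left K).smul_left ε)).add_right
    ((Commute.one_right _).smul_right δ)).ringInverse_ringInverse

variable [CompleteSpace H]

lemma isUnit_add_smul_one (hK : ∀ x, 0 ≤ ⟪K x, x⟫_ℝ) (hε : 0 < ε) :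
    IsUnit (K + ε • (1 : H →L[ℝ] H)) := by
  refine ContinuousLinearMap.isUnit_of_forall_le_norm_inner_map _ (c := ⟨ε, hε.le⟩) hε fun x => ?_
  calc ‖x‖ ^ 2 * ε ≤ ⟪K x, x⟫_ℝ + ε * ‖x‖ ^ 2 := by linarith [hK x]
    _ = ⟪(K + ε • (1 : H →L[ℝ] H)) x, x⟫_ℝ := by simp [inner_add_left, inner_smul_left]
    _ ≤ _ := le_abs_self _

lemma apply_regularizedInverse_add (hK : ∀ x, 0 ≤ ⟪K x, x⟫_ℝ) (hε : 0 < ε) (x : H) :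
    K (regularizedInverse K ε x) + ε • regularizedInverse K ε x = x := by
  simpa [regularizedInverse] using
    DFunLike.congr_fun (Ring.mul_inverse_cancel _ (isUnit_add_smul_one hK hε)) x

lemma regularizedInverse_apply_add (hK : ∀ x, 0 ≤ ⟪K x, x⟫_ℝ) (hε : 0 < ε) (x : H) :
    regularizedInverse K ε (K x) + ε • regularizedInverse K ε x = x := by
  simpa [regularizedInverse] using
    DFunLike.congr_fun (Ring.inverse_mul_cancel _ (isUnit_add_smul_one hK hε)) x

lemma regularizedInverse_apply_comm (hK : ∀ x, 0 ≤ ⟪K x, x⟫_ℝ) (hε : 0 < ε) (x : H) :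
    regularizedInverse K ε (K x) = K (regularizedInverse K ε x) :=
  add_right_cancel <|
    (regularizedInverse_apply_add hK hε x).trans (apply_regularizedInverse_add hK hε x).symm

lemma inner_regularizedInverse_nonneg (hK : ∀ x, 0 ≤ ⟪K x, x⟫_ℝ) (hε : 0 < ε) (x : H) :
    0 ≤ ⟪regularizedInverse K ε x, x⟫_ℝ := by
  have hx := apply_regularizedInverse_add hK hε x
  set y := regularizedInverse K ε x
  rw [← hx, inner_add_right, inner_smul_right, real_inner_comm]
  exact add_nonneg (hK y) (mul_nonneg hε.le real_inner_self_nonneg)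

lemma norm_regularizedInverse_apply_le (hK : ∀ x, 0 ≤ ⟪K x, x⟫_ℝ) (hε : 0 < ε) (z : H) :
    ‖regularizedInverse K ε (K z)‖ ≤ ‖z‖ := by
  have hKy := apply_regularizedInverse_add hK hε (K z)
  set y := regularizedInverse K ε (K z)
  have hdiff : K (z - y) = ε • y := by rw [map_sub, ← hKy]; abel
  have hinner : 0 ≤ ε * ⟪y, z - y⟫_ℝ := by
    simpa [hdiff, real_inner_smul_left] using hK (z - y)
  have hsq : ‖y‖ ^ 2 ≤ ‖y‖ * ‖z‖ := by
    have := nonneg_of_mul_nonneg_right hinner hε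
    rw [inner_sub_right, real_inner_self_eq_norm_sq] at this
    linarith [real_inner_le_norm y z]
  nlinarith [norm_nonneg y, norm_nonneg z]

lemma norm_regularizedInverse_sub_apply_le (hK : ∀ x, 0 ≤ ⟪K x, x⟫_ℝ) (hε : 0 < ε) (hδ : 0 < δ)
    (z : H) :
    ‖(regularizedInverse K ε - regularizedInverse K δ) (K (K z))‖ ≤ |ε - δ| * ‖z‖ := by
  have hres : regularizedInverse K ε - regularizedInverse K δ
      = (δ - ε) • (regularizedInverse K ε * regularizedInverse K δ) := by
    rw [regularizedInverse, regularizedInverse, Ring.inverse_sub_inverse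
      (iff_of_true (isUnit_add_smul_one hK hε) (isUnit_add_smul_one hK hδ)),
      add_sub_add_left_eq_sub, ← sub_smul, mul_smul_comm, mul_one, smul_mul_assoc]
  rw [hres, smul_apply, mul_apply_eq_comp,
    regularizedInverse_apply_comm hK hδ, norm_smul, Real.norm_eq_abs, abs_sub_comm]
  gcongr
  exact (norm_regularizedInverse_apply_le hK hε _).trans
    (norm_regularizedInverse_apply_le hK hδ _)

lemma denseRange_comp_self (hK : K.IsPositive) (hinj : Function.Injective K) :
    DenseRange (K ∘ K) := by
  have horth : ((K * K : H →L[ℝ] H) : H →ₗ[ℝ] H).rangeᗮ = ⊥ := by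
    refine (Submodule.eq_bot_iff _).2 fun x hx => hinj (hinj ?_)
    have h := (Submodule.mem_orthogonal _ x).1 hx (K (K (K (K x)))) ⟨K (K x), rfl⟩
    rw [hK.inner_left_eq_inner_right, hK.inner_left_eq_inner_right] at h
    simpa using inner_self_eq_zero.1 h
  have hdense := Submodule.dense_iff_topologicalClosure_eq_top.2
    (Submodule.topologicalClosure_eq_top_iff.2 horth)
  rwa [LinearMap.coe_range] at hdense

end RegularizedInverse

section Exponential

open NormedSpace

variable {H : Type*} [NormedAddCommGroup H] [InnerProductSpace ℝ H] [CompleteSpace H]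
  {A B : H →L[ℝ] H} {t : ℝ}

lemma hasDerivAt_exp_smul_apply (A : H →L[ℝ] H) (t : ℝ) (x : H) :
    HasDerivAt (fun s : ℝ => exp (s • A) x) (A (exp (t • A) x)) t := by
  simpa using (hasDerivAt_exp_smul_const' (𝕂 := ℝ) A t).clm_apply (hasDerivAt_const t x)

lemma norm_exp_smul_neg_apply_le (hB : ∀ x, 0 ≤ ⟪B x, x⟫_ℝ) (ht : 0 ≤ t) (x : H) :
    ‖exp (t • -B) x‖ ≤ ‖x‖ := by
  have hd (s : ℝ) := (hasDerivAt_exp_smul_apply (-B) s x).norm_sq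
  have hanti : Antitone fun s : ℝ => ‖exp (s • -B) x‖ ^ 2 := by
    refine antitone_of_deriv_nonpos (fun s => (hd s).differentiableAt) fun s => ?_
    rw [(hd s).deriv, neg_apply, inner_neg_right, real_inner_comm]
    linarith [hB (exp (s • -B) x)]
  simpa using le_of_sq_le_sq (hanti ht) (norm_nonneg _)

-- Differentiate `s ↦ e^{-(t-s)B} e^{-sA} x`, which interpolates between the two exponentials.
lemma norm_exp_smul_neg_sub_apply_le (hA : ∀ x, 0 ≤ ⟪A x, x⟫_ℝ) (hB : ∀ x, 0 ≤ ⟪B x, x⟫_ℝ)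
    (hAB : Commute A B) (ht : 0 ≤ t) (x : H) :
    ‖exp (t • -A) x - exp (t • -B) x‖ ≤ ‖(A - B) x‖ * t := by
  have hd (s : ℝ) : HasDerivAt (fun s => exp ((t - s) • -B) (exp (s • -A) x))
      (exp ((t - s) • -B) (exp (s • -A) ((B - A) x))) s := by
    have hB' := (hasDerivAt_exp_smul_const (𝕂 := ℝ) (-B) (t - s)).scomp s
      ((hasDerivAt_id s).const_sub t)
    have hA' := (hasDerivAt_exp_smul_const (𝕂 := ℝ) (-A) s).clm_apply (hasDerivAt_const s x)
    refine (hB'.clm_apply hA').congr_deriv ?_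
    have hcomm (z : H) : B (exp (-(s • A)) z) = exp (-(s • A)) (B z) :=
      DFunLike.congr_fun (hAB.symm.smul_right s).neg_right.exp_right.eq z
    simp [hcomm, sub_eq_add_neg]
  have hbound (s : ℝ) (hs : s ∈ Ico 0 t) :
      ‖exp ((t - s) • -B) (exp (s • -A) ((B - A) x))‖ ≤ ‖(A - B) x‖ := by
    rw [← norm_neg ((A - B) x), ← neg_apply, neg_sub]
    exact (norm_exp_smul_neg_apply_le hB (sub_nonneg.2 hs.2.le) _).trans
      (norm_exp_smul_neg_apply_le hA hs.1 _)
  simpa using norm_image_sub_le_of_norm_deriv_le_segment'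
    (fun s _ => (hd s).hasDerivWithinAt) hbound t ⟨ht, le_rfl⟩

end Exponential

lemma uniformCauchySeqOn_of_dense {ι β X E : Type*} [PseudoMetricSpace X] [PseudoMetricSpace E]
    {p : Filter ι} {s : Set β} {D : Set X} {C : NNReal} {Φ : ι → β → X → E} (hD : Dense D)
    (hΦ : ∀ᶠ i in p, ∀ b ∈ s, LipschitzWith C (Φ i b))
    (h : ∀ z ∈ D, UniformCauchySeqOn (fun i b => Φ i b z) p s) (x : X) :
    UniformCauchySeqOn (fun i b => Φ i b x) p s := by
  intro v hv
  obtain ⟨η, hη, hηv⟩ := Metric.mem_uniformity_dist.1 hv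
  obtain ⟨z, hzD, hz⟩ := hD.exists_dist_lt x (ε := η / (3 * (C + 1))) (by positivity)
  have hclose {i : ι} {b : β} (hL : LipschitzWith C (Φ i b)) :
      dist (Φ i b x) (Φ i b z) ≤ η / 3 := by
    calc dist (Φ i b x) (Φ i b z) ≤ C * (η / (3 * (C + 1))) :=
          (hL.dist_le_mul x z).trans (by gcongr)
      _ ≤ (C + 1) * (η / (3 * (C + 1))) := by gcongr; simp
      _ = η / 3 := by field_simp
  filter_upwards [hΦ.prod_mk hΦ,
    h z hzD _ (Metric.dist_mem_uniformity (ε := η / 3) (by positivity))] with i hLi hi b hb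
  have hz' : dist (Φ i.1 b z) (Φ i.2 b z) < η / 3 := hi b hb
  refine hηv ?_
  calc dist (Φ i.1 b x) (Φ i.2 b x)
      ≤ dist (Φ i.1 b x) (Φ i.1 b z) + dist (Φ i.1 b z) (Φ i.2 b z)
        + dist (Φ i.2 b z) (Φ i.2 b x) := dist_triangle4 _ _ _ _
    _ < η / 3 + η / 3 + η / 3 :=
        add_lt_add_of_lt_of_le (add_lt_add_of_le_of_lt (hclose (hLi.1 b hb)) hz')
          ((dist_comm _ _).trans_le (hclose (hLi.2 b hb)))
    _ = η := by ring

section RegularizedFlow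

open NormedSpace

variable {H : Type*} [NormedAddCommGroup H] [InnerProductSpace ℝ H] {K : H →L[ℝ] H} {ε t : ℝ}

/-- The flow of the regularized problem `(K + ε) y' = -y`. -/
noncomputable def regularizedFlow (K : H →L[ℝ] H) (ε t : ℝ) : H →L[ℝ] H :=
  exp (t • -regularizedInverse K ε)

@[simp]
lemma regularizedFlow_zero (K : H →L[ℝ] H) (ε : ℝ) : regularizedFlow K ε 0 = 1 := by
  simp [regularizedFlow]

variable [CompleteSpace H]

lemma hasDerivAt_regularizedFlow_apply (K : H →L[ℝ] H) (ε t : ℝ) (x : H) :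
    HasDerivAt (fun s => regularizedFlow K ε s x)
      (-regularizedInverse K ε (regularizedFlow K ε t x)) t :=
  hasDerivAt_exp_smul_apply _ t x

lemma continuous_regularizedFlow_apply (K : H →L[ℝ] H) (ε : ℝ) (x : H) :
    Continuous fun t => regularizedFlow K ε t x :=
  continuous_iff_continuousAt.2 fun t => (hasDerivAt_regularizedFlow_apply K ε t x).continuousAt

lemma norm_regularizedFlow_apply_le (hK : ∀ x, 0 ≤ ⟪K x, x⟫_ℝ) (hε : 0 < ε) (ht : 0 ≤ t) (x : H) :
    ‖regularizedFlow K ε t x‖ ≤ ‖x‖ :=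
  norm_exp_smul_neg_apply_le (inner_regularizedInverse_nonneg hK hε) ht x

lemma apply_regularizedFlow_add (hK : ∀ x, 0 ≤ ⟪K x, x⟫_ℝ) (hε : 0 < ε) (t : ℝ) (x : H) :
    K (regularizedFlow K ε t x) + ε • regularizedFlow K ε t x
      = K x + ε • x - ∫ s in (0 : ℝ)..t, regularizedFlow K ε s x := by
  have hd (s : ℝ) : HasDerivAt
      (fun r => K (regularizedFlow K ε r x) + ε • regularizedFlow K ε r x)
      (-regularizedFlow K ε s x) s := by
    have hy := hasDerivAt_regularizedFlow_apply K ε s x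
    refine ((K.hasFDerivAt.comp_hasDerivAt s hy).add (hy.const_smul ε)).congr_deriv ?_
    rw [map_neg, smul_neg, ← neg_add, apply_regularizedInverse_add hK hε]
  have hintegral := intervalIntegral.integral_eq_sub_of_hasDerivAt (fun s _ => hd s)
    ((continuous_regularizedFlow_apply K ε x).neg.intervalIntegrable 0 t)
  rw [intervalIntegral.integral_neg, regularizedFlow_zero, one_apply_eq_self] at hintegral
  rw [sub_eq_add_neg, hintegral]
  abel

lemma uniformCauchySeqOn_regularizedFlow (hK : K.IsPositive) (hinj : Function.Injective K)
    (T : ℝ) (x : H) :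
    UniformCauchySeqOn (fun ε t => regularizedFlow K ε t x) (𝓝[>] 0) (Icc 0 T) := by
  have hacc := hK.inner_nonneg_left
  have hpos : ∀ᶠ ε : ℝ in 𝓝[>] 0, 0 < ε := self_mem_nhdsWithin
  refine uniformCauchySeqOn_of_dense (C := 1) (denseRange_comp_self hK hinj) ?_ ?_ x
  · filter_upwards [hpos] with ε hε t ht
    refine (AddMonoidHomClass.lipschitz_of_bound _ 1 fun z => ?_).weaken (by simp)
    simpa using norm_regularizedFlow_apply_le hacc hε ht.1 z
  rintro _ ⟨z, rfl⟩ v hv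
  obtain ⟨η, hη, hηv⟩ := Metric.mem_uniformity_dist.1 hv
  have hlim : Tendsto (fun ε : ℝ × ℝ => |ε.1 - ε.2| * ‖z‖ * T) (𝓝[>] 0 ×ˢ 𝓝[>] 0) (𝓝 0) := by
    have hcont : Continuous fun ε : ℝ × ℝ => |ε.1 - ε.2| * ‖z‖ * T := by fun_prop
    refine (hcont.tendsto' (0, 0) 0 (by simp)).mono_left ?_
    rw [nhds_prod_eq]
    exact prod_mono nhdsWithin_le_nhds nhdsWithin_le_nhds
  filter_upwards [hpos.prod_mk hpos, hlim.eventually_lt_const hη] with ε hε hlt t ht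
  refine hηv ?_
  calc dist (regularizedFlow K ε.1 t (K (K z))) (regularizedFlow K ε.2 t (K (K z)))
      ≤ ‖(regularizedInverse K ε.1 - regularizedInverse K ε.2) (K (K z))‖ * t := by
        rw [dist_eq_norm]
        exact norm_exp_smul_neg_sub_apply_le (inner_regularizedInverse_nonneg hacc hε.1)
          (inner_regularizedInverse_nonneg hacc hε.2) (commute_regularizedInverse K _ _) ht.1 _
    _ ≤ |ε.1 - ε.2| * ‖z‖ * T :=
        mul_le_mul (norm_regularizedInverse_sub_apply_le hacc hε.1 hε.2 z) ht.2 ht.1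
          (by positivity)
    _ < η := hlt

lemma exists_tendstoUniformlyOn_regularizedFlow (hK : K.IsPositive) (hinj : Function.Injective K)
    (T : ℝ) (x : H) :
    ∃ y, TendstoUniformlyOn (fun ε t => regularizedFlow K ε t x) y (𝓝[>] 0) (Icc 0 T) := by
  have hcauchy := uniformCauchySeqOn_regularizedFlow hK hinj T x
  choose! y hy using fun t (ht : t ∈ Icc 0 T) =>
    cauchy_iff_exists_le_nhds.1 (hcauchy.cauchy_map ht)
  exact ⟨y, hcauchy.tendstoUniformlyOn_of_tendsto hy⟩

end RegularizedFlow

section MildSolution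

variable {H : Type*} [NormedAddCommGroup H] [InnerProductSpace ℝ H]

/-- The integrated form of the evolution equation `K f' = F - f`, `f 0 = x` on `[0, T]`, for a
continuous `f`. For an injective `K` this is the equation `f' = K⁻¹ (F - f)`. -/
structure IsMildSolution (K : H →L[ℝ] H) (T : ℝ) (x : H) (F f : ℝ → H) : Prop where
  continuousOn : ContinuousOn f (Icc 0 T)
  apply_eq : ∀ t ∈ Icc 0 T, K (f t) = K x + ∫ s in (0 : ℝ)..t, (F s - f s)

lemma exists_isMildSolution_zero [CompleteSpace H] {K : H →L[ℝ] H} (hK : K.IsPositive)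
    (hinj : Function.Injective K) (T : ℝ) (x : H) :
    ∃ f, IsMildSolution K T x 0 f := by
  obtain ⟨y, hy⟩ := exists_tendstoUniformlyOn_regularizedFlow hK hinj T x
  have hacc := hK.inner_nonneg_left
  have hpos : ∀ᶠ ε : ℝ in 𝓝[>] 0, 0 < ε := self_mem_nhdsWithin
  have hεlim : Tendsto (fun ε : ℝ => ε) (𝓝[>] 0) (𝓝 0) := nhdsWithin_le_nhds
  have hcont (ε : ℝ) : Continuous fun t => regularizedFlow K ε t x :=
    continuous_regularizedFlow_apply K ε x
  refine ⟨y, hy.continuousOn (Frequently.of_forall fun ε => (hcont ε).continuousOn),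
    fun t ht => ?_⟩
  have hlhs : Tendsto (fun ε => K (regularizedFlow K ε t x) + ε • regularizedFlow K ε t x)
      (𝓝[>] 0) (𝓝 (K (y t) + (0 : ℝ) • y t)) :=
    ((K.continuous.tendsto _).comp (hy.tendsto_at ht)).add (hεlim.smul (hy.tendsto_at ht))
  have hintegral : Tendsto (fun ε => ∫ s in (0 : ℝ)..t, regularizedFlow K ε s x) (𝓝[>] 0)
      (𝓝 (∫ s in (0 : ℝ)..t, y s)) := by
    have hmem {s : ℝ} (hs : s ∈ uIoc 0 t) : s ∈ Icc 0 T := by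
      rw [uIoc_of_le ht.1] at hs
      exact ⟨hs.1.le, hs.2.trans ht.2⟩
    refine intervalIntegral.tendsto_integral_filter_of_dominated_convergence (fun _ => ‖x‖)
      (Eventually.of_forall fun ε => (hcont ε).aestronglyMeasurable)
      (hpos.mono fun ε hε => ae_of_all _ fun s hs => ?_) intervalIntegrable_const
      (ae_of_all _ fun s hs => hy.tendsto_at (hmem hs))
    exact norm_regularizedFlow_apply_le hacc hε (hmem hs).1 x
  have hrhs := (tendsto_const_nhds (x := K x)).add (hεlim.smul_const x) |>.sub hintegral
  simpa [sub_eq_add_neg] using tendsto_nhds_unique hlhs <|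
    hrhs.congr' (hpos.mono fun ε hε => (apply_regularizedFlow_add hacc hε t x).symm)

variable {K : H →L[ℝ] H} {T t : ℝ}

lemma apply_eq_zero_of_inner_apply_self_eq_zero (hK : K.IsPositive) {x : H}
    (hx : ⟪K x, x⟫_ℝ = 0) : K x = 0 := by
  have hcs := LinearMap.BilinForm.apply_mul_apply_le_of_forall_zero_le
    ((innerₗ H).comp (K : H →ₗ[ℝ] H)) hK.inner_nonneg_left x (K x)
  have hsymm : ⟪K (K x), x⟫_ℝ = ⟪K x, K x⟫_ℝ := hK.inner_left_eq_inner_right _ _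
  simp only [LinearMap.comp_apply, ContinuousLinearMap.coe_coe, innerₗ_apply_apply, hx, hsymm,
    zero_mul] at hcs
  exact inner_self_eq_zero.1 (mul_self_eq_zero.1 (hcs.antisymm (mul_self_nonneg _)))

lemma hasDerivAt_primitive_of_continuousOn {E : Type*} [NormedAddCommGroup E] [NormedSpace ℝ E]
    [CompleteSpace E] {f : ℝ → E} {a b t : ℝ} (hf : ContinuousOn f (Icc a b)) (ht : t ∈ Ioo a b) :
    HasDerivAt (fun s => ∫ r in a..s, f r) (f t) t := by
  have hn : Icc a b ∈ 𝓝 t := Icc_mem_nhds ht.1 ht.2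
  refine intervalIntegral.integral_hasDerivAt_right ?_
    ⟨_, hn, hf.aestronglyMeasurable measurableSet_Icc⟩ (hf.continuousAt hn)
  exact (hf.mono (Icc_subset_Icc_right ht.2.le)).intervalIntegrable_of_Icc ht.1.le

namespace IsMildSolution

variable {x y : H} {F G f g : ℝ → H}

lemma intervalIntegrable (h : IsMildSolution K T x F f) (ht : t ∈ Icc 0 T) :
    IntervalIntegrable f volume 0 t :=
  (h.continuousOn.mono (Icc_subset_Icc_right ht.2)).intervalIntegrable_of_Icc ht.1

lemma apply_zero (h : IsMildSolution K T x F f) (hinj : Function.Injective K) (hT : 0 ≤ T) :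
    f 0 = x :=
  hinj (by simpa using h.apply_eq 0 ⟨le_rfl, hT⟩)

lemma const (K : H →L[ℝ] H) (T : ℝ) (x : H) :
    IsMildSolution K T x (fun _ => x) (fun _ => x) where
  continuousOn := continuousOn_const
  apply_eq t _ := by simp

lemma neg (h : IsMildSolution K T x F f) : IsMildSolution K T (-x) (-F) (-f) where
  continuousOn := h.continuousOn.neg
  apply_eq t ht := by
    simp only [Pi.neg_apply, map_neg, h.apply_eq t ht, neg_add, ← intervalIntegral.integral_neg,
      neg_sub, neg_sub_neg]

lemma add (hf : IsMildSolution K T x F f) (hg : IsMildSolution K T y G g)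
    (hF : IntervalIntegrable F volume 0 T) (hG : IntervalIntegrable G volume 0 T) :
    IsMildSolution K T (x + y) (F + G) (f + g) where
  continuousOn := hf.continuousOn.add hg.continuousOn
  apply_eq t ht := by
    have hsub : uIcc 0 t ⊆ uIcc 0 T :=
      uIcc_subset_uIcc_left (by rwa [uIcc_of_le (ht.1.trans ht.2)])
    simp only [Pi.add_apply, map_add, hf.apply_eq t ht, hg.apply_eq t ht, add_sub_add_comm]
    rw [intervalIntegral.integral_add ((hF.mono_set hsub).sub (hf.intervalIntegrable ht))
      ((hG.mono_set hsub).sub (hg.intervalIntegrable ht))]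
    abel

variable [CompleteSpace H]

-- With `w = ∫ f` one has `K w' = -w`, so that `⟪K w, w⟫` decreases from `0`.
lemma eqOn_zero (hK : K.IsPositive) (hinj : Function.Injective K)
    (h : IsMildSolution K T 0 0 f) : EqOn f 0 (Icc 0 T) := by
  intro t ht
  have hT : 0 ≤ T := ht.1.trans ht.2
  set w : ℝ → H := fun t => ∫ s in (0 : ℝ)..t, f s with hw
  have hKf (s : ℝ) (hs : s ∈ Icc 0 T) : K (f s) = -w s := by simp [h.apply_eq s hs, hw]
  have hwc : ContinuousOn w (Icc 0 T) := by
    have hintegral := h.intervalIntegrable ⟨hT, le_rfl⟩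
    simpa [uIcc_of_le hT] using
      intervalIntegral.continuousOn_primitive_interval' hintegral left_mem_uIcc
  have hd (s : ℝ) (hs : s ∈ Ioo 0 T) :
      HasDerivAt (fun r => ⟪K (w r), w r⟫_ℝ) (-2 * ⟪w s, w s⟫_ℝ) s := by
    have hw' : HasDerivAt w (f s) s := hasDerivAt_primitive_of_continuousOn h.continuousOn hs
    refine ((K.hasFDerivAt.comp_hasDerivAt s hw').inner ℝ hw').congr_deriv ?_
    simp only [Function.comp_apply]
    rw [hK.inner_left_eq_inner_right, hKf s (Ioo_subset_Icc_self hs), inner_neg_left,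
      inner_neg_right]
    ring
  have hanti : AntitoneOn (fun r => ⟪K (w r), w r⟫_ℝ) (Icc 0 T) := by
    refine antitoneOn_of_hasDerivWithinAt_nonpos (convex_Icc 0 T)
      ((K.continuous.comp_continuousOn hwc).inner hwc)
      (fun s hs => (hd s (by rwa [interior_Icc] at hs)).hasDerivWithinAt) fun s _ => ?_
    linarith [real_inner_self_nonneg (x := w s)]
  have hKw : ⟪K (w t), w t⟫_ℝ = 0 :=
    le_antisymm (by simpa [hw] using hanti ⟨le_rfl, hT⟩ ht ht.1) (hK.inner_nonneg_left _)
  have hwt : w t = 0 :=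
    (map_eq_zero_iff K hinj).1 (apply_eq_zero_of_inner_apply_self_eq_zero hK hKw)
  exact (map_eq_zero_iff K hinj).1 (by rw [hKf t ht, hwt, neg_zero])

lemma eqOn (hK : K.IsPositive) (hinj : Function.Injective K) (hF : IntervalIntegrable F volume 0 T)
    (hf : IsMildSolution K T x F f) (hg : IsMildSolution K T x F g) : EqOn f g (Icc 0 T) := by
  have hdiff := hf.add hg.neg hF hF.neg
  rw [add_neg_cancel, add_neg_cancel] at hdiff
  intro t ht
  simpa [← sub_eq_add_neg, sub_eq_zero] using hdiff.eqOn_zero hK hinj ht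

end IsMildSolution

-- The difference quotient of `⟪f, K g⟫` only involves those of `K f` and `K g`, by symmetry of `K`.
lemma hasDerivAt_inner_apply (hK : (K : H →ₗ[ℝ] H).IsSymmetric) {f g : ℝ → H} {f' g' : H}
    (hf : HasDerivAt (fun s => K (f s)) f' t) (hg : HasDerivAt (fun s => K (g s)) g' t)
    (hgc : ContinuousAt g t) :
    HasDerivAt (fun s => ⟪f s, K (g s)⟫_ℝ) (⟪f t, g'⟫_ℝ + ⟪f', g t⟫_ℝ) t := by
  have hslope : Tendsto (fun s => ⟪f t, slope (fun s => K (g s)) t s⟫_ℝ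
      + ⟪slope (fun s => K (f s)) t s, g s⟫_ℝ) (𝓝[≠] t) (𝓝 (⟪f t, g'⟫_ℝ + ⟪f', g t⟫_ℝ)) :=
    (tendsto_const_nhds.inner (hasDerivAt_iff_tendsto_slope.1 hg)).add
      ((hasDerivAt_iff_tendsto_slope.1 hf).inner (hgc.tendsto.mono_left nhdsWithin_le_nhds))
  refine hasDerivAt_iff_tendsto_slope.2 (hslope.congr fun s => ?_)
  have hsymm (z : H) : ⟪K z, g s⟫_ℝ = ⟪z, K (g s)⟫_ℝ := hK z (g s)
  simp only [slope_def_module, inner_smul_left, inner_smul_right, inner_sub_left, inner_sub_right,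
    hsymm, smul_eq_mul, RCLike.conj_to_real]
  ring

lemma IsMildSolution.integral_inner_eq [CompleteSpace H] (hK : (K : H →ₗ[ℝ] H).IsSymmetric)
    {x : H} {F f g : ℝ → H} (h : IsMildSolution K T x F f) (hF : ContinuousOn F (Icc 0 T))
    (ht : t ∈ Icc 0 T) (hg : ContinuousOn g (Icc 0 t))
    (hKg : ContDiffOn ℝ 1 (fun s => K (g s)) (Icc 0 t)) :
    ∫ s in (0 : ℝ)..t,
        (⟪f s, derivWithin (fun s => K (g s)) (Icc 0 t) s⟫_ℝ + ⟪F s - f s, g s⟫_ℝ)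
      = ⟪f t, K (g t)⟫_ℝ - ⟪f 0, K (g 0)⟫_ℝ := by
  obtain rfl | ht0 := ht.1.eq_or_lt
  · simp
  have hsub : Icc 0 t ⊆ Icc 0 T := Icc_subset_Icc_right ht.2
  have hf := h.continuousOn.mono hsub
  have hFf := hF.sub h.continuousOn
  have hderiv := hKg.continuousOn_derivWithin (uniqueDiffOn_Icc ht0) le_rfl
  refine intervalIntegral.integral_eq_sub_of_hasDerivAt_of_le (f := fun s => ⟪f s, K (g s)⟫_ℝ)
    ht0.le (hf.inner (K.continuous.comp_continuousOn hg)) (fun s hs => ?_)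
    (((hf.inner hderiv).add ((hFf.mono hsub).inner hg)).intervalIntegrable_of_Icc ht0.le)
  have hn : Icc 0 t ∈ 𝓝 s := Icc_mem_nhds hs.1 hs.2
  have hsT : s ∈ Ioo 0 T := ⟨hs.1, hs.2.trans_le ht.2⟩
  refine hasDerivAt_inner_apply hK ?_ ?_ (hg.continuousAt hn)
  · refine ((hasDerivAt_primitive_of_continuousOn hFf hsT).const_add (K x)).congr_of_eventuallyEq ?_
    filter_upwards [hn] with r hr using h.apply_eq r (hsub hr)
  · have hdiff := hKg.differentiableOn one_ne_zero s (Ioo_subset_Icc_self hs)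
    exact hdiff.hasDerivWithinAt.hasDerivAt hn

end MildSolution

section Duhamel

lemma indicator_smul_indicator_sub {E : Type*} [AddCommGroup E] [Module ℝ E] (v : ℝ → ℝ)
    (h : ℝ → E) {r s t : ℝ} (hr : r ∈ Ioc 0 t) (hs : s ∈ Ioc 0 t) :
    (Ioc 0 t).indicator v s • (Ioc 0 t).indicator h (r - s)
      = if s < r then v s • h (r - s) else 0 := by
  have hmem : r - s ∈ Ioc 0 t ↔ s < r :=
    ⟨fun h => sub_pos.1 h.1, fun h => ⟨sub_pos.2 h, by linarith [hr.2, hs.1]⟩⟩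
  simp [indicator_apply, hs, hmem]

lemma integral_smul_integral_sub {E : Type*} [NormedAddCommGroup E] [NormedSpace ℝ E] {t : ℝ}
    (ht : 0 ≤ t) {v : ℝ → ℝ} {h : ℝ → E} (hv : IntegrableOn v (Ioc 0 t))
    (hh : IntegrableOn h (Ioc 0 t)) :
    ∫ s in (0 : ℝ)..t, v s • ∫ r in (0 : ℝ)..(t - s), h r
      = ∫ r in (0 : ℝ)..t, ∫ s in (0 : ℝ)..r, v s • h (r - s) := by
  set v₀ := (Ioc 0 t).indicator v
  set h₀ := (Ioc 0 t).indicator h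
  have hintegral : Integrable (fun p : ℝ × ℝ => v₀ p.2 • h₀ (p.1 - p.2)) :=
    ((integrable_indicator_iff measurableSet_Ioc).2 hv).convolution_integrand
      (ContinuousLinearMap.lsmul ℝ ℝ) ((integrable_indicator_iff measurableSet_Ioc).2 hh)
  have hinner (s : ℝ) (hs : s ∈ Ioc 0 t) :
      ∫ r in Ioc 0 t, v₀ s • h₀ (r - s) = v s • ∫ r in (0 : ℝ)..(t - s), h r := by
    calc ∫ r in Ioc 0 t, v₀ s • h₀ (r - s)
        = ∫ r in Ioc 0 t, (Ioi s).indicator (fun r => v s • h (r - s)) r :=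
          setIntegral_congr_fun measurableSet_Ioc fun r hr => indicator_smul_indicator_sub v h hr hs
      _ = v s • ∫ r in (0 : ℝ)..(t - s), h r := by
          rw [setIntegral_indicator measurableSet_Ioi, Ioc_inter_Ioi, sup_eq_right.2 hs.1.le,
            integral_smul, ← intervalIntegral.integral_of_le hs.2,
            intervalIntegral.integral_comp_sub_right, sub_self]
  have houter (r : ℝ) (hr : r ∈ Ioc 0 t) :
      ∫ s in Ioc 0 t, v₀ s • h₀ (r - s) = ∫ s in (0 : ℝ)..r, v s • h (r - s) := by
    calc ∫ s in Ioc 0 t, v₀ s • h₀ (r - s)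
        = ∫ s in Ioc 0 t, (Iio r).indicator (fun s => v s • h (r - s)) s :=
          setIntegral_congr_fun measurableSet_Ioc fun s hs => indicator_smul_indicator_sub v h hr hs
      _ = ∫ s in (0 : ℝ)..r, v s • h (r - s) := by
          have hset : Ioc 0 t ∩ Iio r = Ioo 0 r := by grind
          rw [setIntegral_indicator measurableSet_Iio, hset,
            intervalIntegral.integral_of_le hr.1.le, integral_Ioc_eq_integral_Ioo]
  calc ∫ s in (0 : ℝ)..t, v s • ∫ r in (0 : ℝ)..(t - s), h r
      = ∫ s in Ioc 0 t, ∫ r in Ioc 0 t, v₀ s • h₀ (r - s) := by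
        rw [intervalIntegral.integral_of_le ht]
        exact setIntegral_congr_fun measurableSet_Ioc fun s hs => (hinner s hs).symm
    _ = ∫ r in Ioc 0 t, ∫ s in Ioc 0 t, v₀ s • h₀ (r - s) := by
        refine (integral_integral_swap (f := fun r s => v₀ s • h₀ (r - s)) ?_).symm
        rw [Measure.prod_restrict]
        exact hintegral.integrableOn
    _ = ∫ r in (0 : ℝ)..t, ∫ s in (0 : ℝ)..r, v s • h (r - s) := by
        rw [intervalIntegral.integral_of_le ht]
        exact setIntegral_congr_fun measurableSet_Ioc houter

variable {H : Type*} [NormedAddCommGroup H] [InnerProductSpace ℝ H] {K : H →L[ℝ] H} {T t : ℝ}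

lemma intervalIntegrable_smul_comp_sub {E : Type*} [NormedAddCommGroup E] [NormedSpace ℝ E]
    (ht : 0 ≤ t) {v : ℝ → ℝ} {Z : ℝ → E} (hv : IntervalIntegrable v volume 0 t)
    (hZ : ContinuousOn Z (Icc 0 t)) :
    IntervalIntegrable (fun s => v s • Z (t - s)) volume 0 t := by
  refine hv.smul_continuousOn ?_
  rw [uIcc_of_le ht]
  exact hZ.comp (by fun_prop) fun s hs => ⟨sub_nonneg.2 hs.2, sub_le_self _ hs.1⟩

lemma continuousOn_integral_smul_comp_sub {E : Type*} [NormedAddCommGroup E] [NormedSpace ℝ E]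
    (hT : 0 ≤ T) {v : ℝ → ℝ} {Z : ℝ → E} (hv : IntegrableOn v (Ioc 0 T))
    (hZ : ContinuousOn Z (Icc 0 T)) (hZ0 : Z 0 = 0) :
    ContinuousOn (fun t => ∫ s in (0 : ℝ)..t, v s • Z (t - s)) (Icc 0 T) := by
  set Z₀ := IccExtend hT ((Icc 0 T).domRestrict Z) with hZ₀
  set v₀ := (Ioc 0 T).indicator v with hv₀
  have hZ₀c : Continuous Z₀ := (continuousOn_iff_continuous_domRestrict.1 hZ).Icc_extend'
  have hZ₀b : BddAbove (range fun x => ‖Z₀ x‖) := by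
    obtain ⟨C, hC⟩ := isCompact_Icc.exists_bound_of_continuousOn hZ
    exact ⟨C, forall_mem_range.2 fun s => hC _ (projIcc 0 T hT s).2⟩
  have hconv := hZ₀b.continuous_convolution_right_of_integrable (ContinuousLinearMap.lsmul ℝ ℝ)
    ((integrable_indicator_iff measurableSet_Ioc).2 hv) hZ₀c
  refine hconv.continuousOn.congr fun t ht => ?_
  have hset (s : ℝ) : v₀ s • Z₀ (t - s) = (Ioc 0 t).indicator (fun s => v s • Z (t - s)) s := by
    by_cases hs : s ∈ Ioc 0 t
    · rw [hv₀, hZ₀, indicator_of_mem (show s ∈ Ioc 0 T from ⟨hs.1, hs.2.trans ht.2⟩),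
        indicator_of_mem hs, IccExtend_of_mem hT _
          (show t - s ∈ Icc 0 T by constructor <;> linarith [hs.1, hs.2, ht.2]), domRestrict_apply]
    · rw [indicator_of_notMem hs]
      rcases le_or_gt s 0 with h0 | h0
      · rw [hv₀, indicator_of_notMem (fun h => h.1.not_ge h0), zero_smul]
      · rw [hZ₀, IccExtend_of_le_left hT _ (by linarith [not_le.1 fun h => hs ⟨h0, h⟩]),
          domRestrict_apply, hZ0, smul_zero]
  rw [convolution_def, intervalIntegral.integral_of_le ht.1, ← integral_indicator measurableSet_Ioc]
  exact integral_congr_ae (ae_of_all _ fun s => (hset s).symm)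

variable [CompleteSpace H] {e : H}

-- Duhamel's principle: the response to `(∫ v) e` superposes delayed copies of the response to `e`.
lemma IsMildSolution.duhamel {Z : ℝ → H} (hinj : Function.Injective K) (hT : 0 ≤ T)
    (hZ : IsMildSolution K T 0 (fun _ => e) Z) {v : ℝ → ℝ} (hv : IntegrableOn v (Ioc 0 T)) :
    IsMildSolution K T 0 (fun t => (∫ s in (0 : ℝ)..t, v s) • e)
      (fun t => ∫ s in (0 : ℝ)..t, v s • Z (t - s)) where
  continuousOn := continuousOn_integral_smul_comp_sub hT hv hZ.continuousOn (hZ.apply_zero hinj hT)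
  apply_eq t ht := by
    have hvi {r : ℝ} (hr : r ∈ Icc 0 T) : IntervalIntegrable v volume 0 r :=
      (intervalIntegrable_iff_integrableOn_Ioc_of_le hr.1).2
        (hv.mono_set (Ioc_subset_Ioc_right hr.2))
    have hZi {r : ℝ} (hr : r ∈ Icc 0 T) :
        IntervalIntegrable (fun s => v s • Z (r - s)) volume 0 r :=
      intervalIntegrable_smul_comp_sub hr.1 (hvi hr)
        (hZ.continuousOn.mono (Icc_subset_Icc_right hr.2))
    calc K (∫ s in (0 : ℝ)..t, v s • Z (t - s))
        = ∫ s in (0 : ℝ)..t, v s • ∫ r in (0 : ℝ)..(t - s), (e - Z r) := by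
          rw [← K.intervalIntegral_comp_comm (hZi ht)]
          refine intervalIntegral.integral_congr fun s hs => ?_
          rw [uIcc_of_le ht.1] at hs
          simp only [map_smul]
          rw [hZ.apply_eq (t - s) (by constructor <;> linarith [hs.1, hs.2, ht.2]), map_zero,
            zero_add]
      _ = ∫ r in (0 : ℝ)..t, ∫ s in (0 : ℝ)..r, v s • (e - Z (r - s)) :=
          integral_smul_integral_sub ht.1 (hv.mono_set (Ioc_subset_Ioc_right ht.2))
            ((intervalIntegrable_iff_integrableOn_Ioc_of_le ht.1).1
              (intervalIntegrable_const.sub (hZ.intervalIntegrable ht)))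
      _ = K 0 + ∫ r in (0 : ℝ)..t, ((∫ s in (0 : ℝ)..r, v s) • e
            - ∫ s in (0 : ℝ)..r, v s • Z (r - s)) := by
          rw [map_zero, zero_add]
          refine intervalIntegral.integral_congr fun r hr => ?_
          rw [uIcc_of_le ht.1] at hr
          have hrT : r ∈ Icc 0 T := ⟨hr.1, hr.2.trans ht.2⟩
          simp only [smul_sub]
          rw [intervalIntegral.integral_sub ((hvi hrT).smul_continuousOn continuousOn_const)
            (hZi hrT), intervalIntegral.integral_smul_const]

lemma exists_isMildSolution (hK : K.IsPositive) (hinj : Function.Injective K) (hT : 0 ≤ T)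
    (x e : H) (c : ℝ) {v : ℝ → ℝ} (hv : IntegrableOn v (Ioc 0 T)) :
    ∃ f, IsMildSolution K T x (fun t => (c + ∫ s in (0 : ℝ)..t, v s) • e) f := by
  obtain ⟨y, hy⟩ := exists_isMildSolution_zero hK hinj T (-e)
  have hstep : IsMildSolution K T 0 (fun _ => e) (y + fun _ => e) := by
    simpa using hy.add (.const K T e) intervalIntegrable_const intervalIntegrable_const
  obtain ⟨z, hz⟩ := exists_isMildSolution_zero hK hinj T (x - c • e)
  have hconst : IsMildSolution K T x (fun _ => c • e) (z + fun _ => c • e) := by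
    simpa using hz.add (.const K T (c • e)) intervalIntegrable_const intervalIntegrable_const
  have hforce : IntervalIntegrable (fun t => (∫ s in (0 : ℝ)..t, v s) • e) volume 0 T := by
    have hv' := (intervalIntegrable_iff_integrableOn_Ioc_of_le hT).2 hv
    exact ((intervalIntegral.continuousOn_primitive_interval' hv' left_mem_uIcc).smul
      continuousOn_const).intervalIntegrable
  have hsol := hconst.add (hstep.duhamel hinj hT hv) intervalIntegrable_const hforce
  rw [add_zero] at hsol
  simp only [add_smul]
  exact ⟨_, hsol⟩

end Duhamel

section WeakDerivative

variable {a b : ℝ} {f f' g g' φ ψ χ : ℝ → ℝ}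

/-- `φ` is a test function on `(a, b)`: a smooth function on the line whose support is a compact
subset of `(a, b)`. -/
structure MemCcInfty (a b : ℝ) (φ : ℝ → ℝ) : Prop where
  contDiff : ContDiff ℝ ∞ φ
  hasCompactSupport : HasCompactSupport φ
  tsupport_subset : tsupport φ ⊆ Ioo a b

namespace MemCcInfty

lemma continuous (h : MemCcInfty a b φ) : Continuous φ := h.contDiff.continuous

lemma hasDerivAt (h : MemCcInfty a b φ) (x : ℝ) : HasDerivAt φ (deriv φ x) x :=
  (h.contDiff.differentiable (by simp)).differentiableAt.hasDerivAt

lemma integrable (h : MemCcInfty a b φ) : Integrable φ :=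
  h.continuous.integrable_of_hasCompactSupport h.hasCompactSupport

lemma apply_eq_zero (h : MemCcInfty a b φ) {x : ℝ} (hx : x ∉ Ioo a b) : φ x = 0 :=
  image_eq_zero_of_notMem_tsupport fun hx' => hx (h.tsupport_subset hx')

lemma setIntegral_mul (h : MemCcInfty a b φ) (g : ℝ → ℝ) :
    ∫ x in Ioo a b, g x * φ x = ∫ x, g x * φ x :=
  setIntegral_eq_integral_of_forall_compl_eq_zero fun x hx => by rw [h.apply_eq_zero hx, mul_zero]

lemma deriv (h : MemCcInfty a b φ) : MemCcInfty a b (deriv φ) where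
  contDiff := (contDiff_infty_iff_deriv.1 h.contDiff).2
  hasCompactSupport := h.hasCompactSupport.deriv
  tsupport_subset := tsupport_deriv_subset.trans h.tsupport_subset

lemma sub (h : MemCcInfty a b φ) (h' : MemCcInfty a b ψ) :
    MemCcInfty a b fun x => φ x - ψ x where
  contDiff := h.contDiff.sub h'.contDiff
  hasCompactSupport := h.hasCompactSupport.sub h'.hasCompactSupport
  tsupport_subset := (tsupport_sub φ ψ).trans (union_subset h.tsupport_subset h'.tsupport_subset)

lemma mul_left (h : MemCcInfty a b φ) (hχ : ContDiffOn ℝ ∞ χ (Ioo a b)) :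
    MemCcInfty a b fun x => χ x * φ x where
  contDiff := by
    refine contDiff_iff_contDiffAt.2 fun x => ?_
    by_cases hx : x ∈ tsupport φ
    · exact (hχ.contDiffAt (isOpen_Ioo.mem_nhds (h.tsupport_subset hx))).mul h.contDiff.contDiffAt
    · refine contDiffAt_const (c := (0 : ℝ)) |>.congr_of_eventuallyEq ?_
      filter_upwards [notMem_tsupport_iff_eventuallyEq.1 hx] with y hy
      rw [hy, Pi.zero_apply, mul_zero]
  hasCompactSupport := h.hasCompactSupport.mul_left
  tsupport_subset := tsupport_mul_subset_right.trans h.tsupport_subset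

lemma integrable_mul (h : MemCcInfty a b φ) (hg : LocallyIntegrableOn g (Ioo a b)) :
    IntegrableOn (fun x => g x * φ x) (Ioo a b) := by
  have hcompact : IntegrableOn (fun x => g x * φ x) (tsupport φ) :=
    (hg.integrableOn_compact_subset h.tsupport_subset h.hasCompactSupport).mul_continuousOn
      h.continuous.continuousOn h.hasCompactSupport
  have hsupp : Function.support (fun x => g x * φ x) ⊆ tsupport φ := fun x hx =>
    subset_tsupport φ (right_ne_zero_of_mul hx)
  exact ((integrableOn_iff_integrable_of_support_subset hsupp).1 hcompact).integrableOn

end MemCcInfty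

lemma exists_memCcInfty_integral_eq_one (hab : a < b) :
    ∃ ρ, MemCcInfty a b ρ ∧ ∫ x, ρ x = 1 := by
  let B : ContDiffBump ((a + b) / 2) := ⟨(b - a) / 8, (b - a) / 4, by linarith, by linarith⟩
  refine ⟨B.normed volume, ⟨B.contDiff_normed, B.hasCompactSupport_normed, ?_⟩, B.integral_normed⟩
  rw [B.tsupport_normed_eq, Real.closedBall_eq_Icc]
  change Icc ((a + b) / 2 - (b - a) / 4) ((a + b) / 2 + (b - a) / 4) ⊆ Ioo a b
  exact Icc_subset_Ioo (by linarith) (by linarith)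

lemma hasDerivAt_primitive (hf : Continuous f) (c x : ℝ) :
    HasDerivAt (fun x => ∫ s in c..x, f s) (f x) x :=
  intervalIntegral.integral_hasDerivAt_right (hf.intervalIntegrable _ _)
    (hf.stronglyMeasurableAtFilter _ _) hf.continuousAt

lemma deriv_primitive (hf : Continuous f) (c : ℝ) : deriv (fun x => ∫ s in c..x, f s) = f :=
  funext fun x => (hasDerivAt_primitive hf c x).deriv

lemma contDiff_primitive (hf : ContDiff ℝ ∞ f) (c : ℝ) :
    ContDiff ℝ ∞ fun x => ∫ s in c..x, f s :=
  contDiff_infty_iff_deriv.2 ⟨fun x => (hasDerivAt_primitive hf.continuous c x).differentiableAt,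
    (deriv_primitive hf.continuous c).symm ▸ hf⟩

lemma MemCcInfty.exists_deriv_eq (h : MemCcInfty a b φ) (h0 : ∫ x, φ x = 0) :
    ∃ θ, MemCcInfty a b θ ∧ _root_.deriv θ = φ := by
  rcases (tsupport φ).eq_empty_or_nonempty with hempty | hne
  · exact ⟨φ, h, by simp [tsupport_eq_empty_iff.1 hempty]⟩
  obtain ⟨c, hc⟩ := h.hasCompactSupport.isCompact.exists_isLeast hne
  obtain ⟨d, hd⟩ := h.hasCompactSupport.isCompact.exists_isGreatest hne
  have hsupp : Function.support (fun x => ∫ s in (c - 1)..x, φ s) ⊆ Icc c d := by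
    refine Function.support_subset_iff'.2 fun x hx => ?_
    have hφ {s : ℝ} (hs : s ∈ Function.support φ) : s ∈ Icc c d :=
      ⟨hc.2 (subset_tsupport φ hs), hd.2 (subset_tsupport φ hs)⟩
    rcases le_or_gt c x with hcx | hcx
    · rw [← h0]
      refine intervalIntegral.integral_eq_integral_of_support_subset fun s hs => ?_
      exact ⟨by linarith [(hφ hs).1], (hφ hs).2.trans (not_le.1 fun h => hx ⟨hcx, h⟩).le⟩
    · refine intervalIntegral.integral_zero_ae (ae_of_all _ fun s hs => ?_)
      refine Function.notMem_support.1 fun hs' => (hφ hs').1.not_gt ?_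
      exact hs.2.trans_lt (max_lt (by linarith) hcx)
  refine ⟨_, ⟨contDiff_primitive h.contDiff (c - 1),
    .of_support_subset_isCompact isCompact_Icc hsupp, ?_⟩, deriv_primitive h.continuous _⟩
  exact (closure_minimal hsupp isClosed_Icc).trans
    (Icc_subset_Ioo (h.tsupport_subset hc.1).1 (h.tsupport_subset hd.1).2)

lemma ae_eq_of_integral_mul_eq (hf : LocallyIntegrableOn f (Ioo a b))
    (hg : LocallyIntegrableOn g (Ioo a b))
    (h : ∀ φ, MemCcInfty a b φ → ∫ x in Ioo a b, f x * φ x = ∫ x in Ioo a b, g x * φ x) :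
    f =ᵐ[volume.restrict (Ioo a b)] g := by
  have hzero := isOpen_Ioo.ae_eq_zero_of_integral_contDiff_smul_eq_zero (hf.sub hg)
    fun φ hφ hc hs => by
      have hφ : MemCcInfty a b φ := ⟨hφ, hc, hs⟩
      calc ∫ x, φ x • (f x - g x) = ∫ x in Ioo a b, (f x - g x) * φ x := by
            rw [hφ.setIntegral_mul]
            simp only [smul_eq_mul, mul_comm]
        _ = 0 := by
            simp only [sub_mul]
            rw [integral_sub (hφ.integrable_mul hf) (hφ.integrable_mul hg), h φ hφ, sub_self]
  filter_upwards [(ae_restrict_iff' measurableSet_Ioo).2 hzero] with x hx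
  exact sub_eq_zero.1 hx

namespace HasWeakDeriv

lemma integral_mul_deriv (h : HasWeakDeriv a b f g) (hφ : MemCcInfty a b φ) :
    ∫ x in Ioo a b, f x * deriv φ x = -∫ x in Ioo a b, g x * φ x :=
  h.2.2 φ hφ.contDiff hφ.hasCompactSupport hφ.tsupport_subset

lemma ae_eq (h : HasWeakDeriv a b f g) (h' : HasWeakDeriv a b f g') :
    g =ᵐ[volume.restrict (Ioo a b)] g' :=
  ae_eq_of_integral_mul_eq h.2.1 h'.2.1 fun _ hφ => neg_injective <| by
    rw [← h.integral_mul_deriv hφ, ← h'.integral_mul_deriv hφ]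

lemma congr_ae (h : HasWeakDeriv a b f g) (hf : f =ᵐ[volume.restrict (Ioo a b)] f')
    (hg : g =ᵐ[volume.restrict (Ioo a b)] g') : HasWeakDeriv a b f' g' := by
  have hloc {k k' : ℝ → ℝ} (hk : LocallyIntegrableOn k (Ioo a b))
      (hkk' : k =ᵐ[volume.restrict (Ioo a b)] k') : LocallyIntegrableOn k' (Ioo a b) := by
    rw [locallyIntegrableOn_iff isOpen_Ioo.isLocallyClosed] at hk ⊢
    exact fun K hK hKc => (hk K hK hKc).congr (ae_restrict_of_ae_restrict_of_subset hK hkk')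
  refine ⟨hloc h.1 hf, hloc h.2.1 hg, fun φ hφ hc hs => ?_⟩
  calc ∫ x in Ioo a b, f' x * deriv φ x = ∫ x in Ioo a b, f x * deriv φ x :=
        integral_congr_ae (hf.symm.mul .rfl)
    _ = -∫ x in Ioo a b, g x * φ x := h.2.2 φ hφ hc hs
    _ = -∫ x in Ioo a b, g' x * φ x := congrArg Neg.neg (integral_congr_ae (hg.mul .rfl))

lemma sub (h : HasWeakDeriv a b f g) (h' : HasWeakDeriv a b f' g') :
    HasWeakDeriv a b (fun x => f x - f' x) fun x => g x - g' x := by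
  refine ⟨h.1.sub h'.1, h.2.1.sub h'.2.1, fun φ hφ hc hs => ?_⟩
  have hφ : MemCcInfty a b φ := ⟨hφ, hc, hs⟩
  simp only [sub_mul]
  rw [integral_sub (hφ.deriv.integrable_mul h.1) (hφ.deriv.integrable_mul h'.1),
    integral_sub (hφ.integrable_mul h.2.1) (hφ.integrable_mul h'.2.1),
    h.integral_mul_deriv hφ, h'.integral_mul_deriv hφ]
  ring

lemma mul_left (h : HasWeakDeriv a b f g) (hχ : ContDiffOn ℝ ∞ χ (Ioo a b)) :
    HasWeakDeriv a b (fun x => χ x * f x) fun x => deriv χ x * f x + χ x * g x := by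
  have hχ' : ContinuousOn (deriv χ) (Ioo a b) :=
    hχ.continuousOn_deriv_of_isOpen isOpen_Ioo (by simp)
  have hloc {k l : ℝ → ℝ} (hk : ContinuousOn k (Ioo a b)) (hl : LocallyIntegrableOn l (Ioo a b)) :
      LocallyIntegrableOn (fun x => k x * l x) (Ioo a b) :=
    hl.continuousOn_mul hk isOpen_Ioo.isLocallyClosed
  refine ⟨hloc hχ.continuousOn h.1, (hloc hχ' h.1).add (hloc hχ.continuousOn h.2.1),
    fun φ hφ hc hs => ?_⟩
  have hφ : MemCcInfty a b φ := ⟨hφ, hc, hs⟩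
  have hχφ : MemCcInfty a b fun x => χ x * φ x := hφ.mul_left hχ
  have hderiv : ∀ x ∈ Ioo a b,
      χ x * f x * deriv φ x = f x * deriv (fun x => χ x * φ x) x - deriv χ x * f x * φ x := by
    intro x hx
    have hχx := (hχ.contDiffAt (isOpen_Ioo.mem_nhds hx)).differentiableAt (by simp)
    rw [(hχx.hasDerivAt.fun_mul (hφ.hasDerivAt x)).deriv]
    ring
  rw [setIntegral_congr_fun measurableSet_Ioo hderiv,
    integral_sub (hχφ.deriv.integrable_mul h.1) (hφ.integrable_mul (hloc hχ' h.1)),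
    h.integral_mul_deriv hχφ]
  simp only [add_mul]
  rw [integral_add (hφ.integrable_mul (hloc hχ' h.1))
    (hφ.integrable_mul (hloc hχ.continuousOn h.2.1))]
  simp only [mul_assoc, mul_left_comm (χ _)]
  ring

lemma exists_ae_eq_const (hab : a < b) (h : HasWeakDeriv a b f 0) :
    ∃ c : ℝ, f =ᵐ[volume.restrict (Ioo a b)] fun _ => c := by
  obtain ⟨ρ, hρ, hρ1⟩ := exists_memCcInfty_integral_eq_one hab
  refine ⟨∫ x in Ioo a b, f x * ρ x, ae_eq_of_integral_mul_eq h.1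
    (continuousOn_const.locallyIntegrableOn measurableSet_Ioo) fun φ hφ => ?_⟩
  -- `φ` differs from a multiple of `ρ` by the derivative of a test function.
  have hmρ : MemCcInfty a b fun x => (∫ y, φ y) * ρ x := hρ.mul_left contDiffOn_const
  obtain ⟨θ, hθ, hθ'⟩ := (hφ.sub hmρ).exists_deriv_eq (by
    rw [integral_sub hφ.integrable hmρ.integrable, integral_const_mul, hρ1, mul_one, sub_self])
  have hortho := h.integral_mul_deriv hθ
  simp only [hθ', Pi.zero_apply, zero_mul, integral_zero, neg_zero, mul_sub] at hortho
  rw [integral_sub (hφ.integrable_mul h.1) (hmρ.integrable_mul h.1), sub_eq_zero] at hortho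
  rw [hortho, hφ.setIntegral_mul, integral_const_mul, mul_comm, ← integral_const_mul]
  simp only [mul_left_comm]

end HasWeakDeriv

lemma weakDeriv_ae_eq (h : HasWeakDeriv a b f g) :
    weakDeriv a b f =ᵐ[volume.restrict (Ioo a b)] g := by
  have hex : ∃ g, HasWeakDeriv a b f g := ⟨g, h⟩
  rw [weakDeriv, dif_pos hex]
  exact hex.choose_spec.ae_eq h

lemma hasWeakDeriv_deriv (hf : ContDiff ℝ 1 f) : HasWeakDeriv a b f (deriv f) := by
  have hf' : Continuous (deriv f) := hf.continuous_deriv le_rfl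
  refine ⟨hf.continuous.locallyIntegrable.locallyIntegrableOn _,
    hf'.locallyIntegrable.locallyIntegrableOn _, fun φ hφ hc hs => ?_⟩
  have hφ : MemCcInfty a b φ := ⟨hφ, hc, hs⟩
  have hintegral {k θ : ℝ → ℝ} (hk : Continuous k) (hθ : MemCcInfty a b θ) :
      Integrable (k * θ) :=
    (hk.mul hθ.continuous).integrable_of_hasCompactSupport hθ.hasCompactSupport.mul_left
  rw [hφ.deriv.setIntegral_mul, hφ.setIntegral_mul]
  exact integral_mul_deriv_eq_deriv_mul_of_integrable
    (fun x _ => (hf.differentiable one_ne_zero x).hasDerivAt) (fun x _ => hφ.hasDerivAt x)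
    (hintegral hf.continuous hφ.deriv) (hintegral hf' hφ) (hintegral hf.continuous hφ)

lemma integral_primitive_mul (hf : IntervalIntegrable f volume a b)
    (hg : IntervalIntegrable g volume a b) :
    ∫ x in a..b, (∫ s in a..x, f s) * g x = -∫ x in a..b, f x * ∫ s in b..x, g s := by
  have hF := hf.absolutelyContinuousOnInterval_intervalIntegral (c := a) left_mem_uIcc
  have hG := hg.absolutelyContinuousOnInterval_intervalIntegral (c := b) right_mem_uIcc
  have hparts := hF.integral_mul_deriv_eq_deriv_mul hG
  simp only [intervalIntegral.integral_same, mul_zero, zero_mul, sub_zero, zero_sub] at hparts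
  convert hparts using 1
  · refine intervalIntegral.integral_congr_ae ?_
    filter_upwards [hg.ae_hasDerivAt_integral] with x hx hxab
    rw [(hx (uIoc_subset_uIcc hxab) b right_mem_uIcc).deriv]
  · congr 1
    refine intervalIntegral.integral_congr_ae ?_
    filter_upwards [hf.ae_hasDerivAt_integral] with x hx hxab
    rw [(hx (uIoc_subset_uIcc hxab) a left_mem_uIcc).deriv]

lemma continuousOn_primitive (hg : IntegrableOn g (Ioo a b)) :
    ContinuousOn (fun x => ∫ s in a..x, g s) (Icc a b) := by
  rcases le_or_gt a b with hab | hab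
  · have h := intervalIntegral.continuousOn_primitive_interval (μ := volume) (f := g) (a := a)
      (b := b) (by rwa [uIcc_of_le hab, integrableOn_Icc_iff_integrableOn_Ioo])
    rwa [uIcc_of_le hab] at h
  · simp [Icc_eq_empty hab.not_ge]

lemma hasWeakDeriv_primitive (hg : IntegrableOn g (Ioo a b)) :
    HasWeakDeriv a b (fun x => ∫ s in a..x, g s) g := by
  refine ⟨((continuousOn_primitive hg).mono Ioo_subset_Icc_self).locallyIntegrableOn
    measurableSet_Ioo, hg.locallyIntegrableOn, fun φ hφ hc hs => ?_⟩
  have hφ : MemCcInfty a b φ := ⟨hφ, hc, hs⟩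
  rcases le_or_gt a b with hab | hab
  · have hprim (x : ℝ) : ∫ s in b..x, deriv φ s = φ x := by
      rw [intervalIntegral.integral_eq_sub_of_hasDerivAt (fun s _ => hφ.hasDerivAt s)
        (hφ.deriv.continuous.intervalIntegrable _ _), hφ.apply_eq_zero right_notMem_Ioo, sub_zero]
    have hparts := integral_primitive_mul ((intervalIntegrable_iff_integrableOn_Ioo_of_le hab).2 hg)
      (hφ.deriv.continuous.intervalIntegrable a b)
    simpa only [hprim, intervalIntegral.integral_of_le hab, integral_Ioc_eq_integral_Ioo]
      using hparts
  · simp [Ioo_eq_empty hab.not_gt]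

lemma HasWeakDeriv.exists_ae_eq_primitive (hab : a < b) (h : HasWeakDeriv a b f g)
    (hg : IntegrableOn g (Ioo a b)) :
    ∃ c : ℝ, f =ᵐ[volume.restrict (Ioo a b)] fun x => c + ∫ s in a..x, g s := by
  have hsub := h.sub (hasWeakDeriv_primitive hg)
  simp only [sub_self] at hsub
  obtain ⟨c, hc⟩ := hsub.exists_ae_eq_const hab
  exact ⟨c, hc.mono fun x hx => sub_eq_iff_eq_add.1 hx⟩

end WeakDerivative

lemma memLp_of_continuousOn {a b : ℝ} {f : ℝ → ℝ} (hf : ContinuousOn f (Icc a b)) (p : ENNReal) :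
    MemLp f p (volume.restrict (Ioo a b)) := by
  obtain ⟨C, hC⟩ := isCompact_Icc.exists_bound_of_continuousOn hf
  refine .of_bound ((hf.mono Ioo_subset_Icc_self).aestronglyMeasurable measurableSet_Ioo) C ?_
  filter_upwards [ae_restrict_mem measurableSet_Ioo] with x hx
  exact hC x (Ioo_subset_Icc_self hx)

namespace L2

lemma inner_eq (f g : L2) : ⟪f, g⟫_ℝ = ∫ x in Ioo (0 : ℝ) 1, f x * g x := by
  simp only [MeasureTheory.L2.inner_def, RCLike.inner_apply, conj_trivial, mul_comm]

lemma integrableOn (f : L2) : IntegrableOn f (Ioo (0 : ℝ) 1) :=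
  (Lp.memLp f).integrable (by norm_num)

lemma intervalIntegrable (f : L2) {x : ℝ} (hx : x ∈ Icc (0 : ℝ) 1) :
    IntervalIntegrable f volume 0 x :=
  (intervalIntegrable_iff_integrableOn_Ioo_of_le hx.1).2
    (f.integrableOn.mono_set (Ioo_subset_Ioo_right hx.2))

lemma abs_primitive_le (f : L2) {x : ℝ} (hx : x ∈ Icc (0 : ℝ) 1) :
    |∫ s in (0 : ℝ)..x, f s| ≤ x ^ (1 / 2 : ℝ) * ‖f‖ := by
  have hinter : Ioo 0 x ∩ Ioo 0 1 = Ioo 0 x := inter_eq_left.2 (Ioo_subset_Ioo_right hx.2)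
  have hinner := MeasureTheory.L2.inner_indicatorConstLp_one (𝕜 := ℝ) (measurableSet_Ioo (a := 0)
    (b := x)) (measure_ne_top (volume.restrict (Ioo (0 : ℝ) 1)) _) f
  rw [Measure.restrict_restrict measurableSet_Ioo, hinter] at hinner
  rw [intervalIntegral.integral_of_le hx.1, integral_Ioc_eq_integral_Ioo, ← hinner]
  refine (abs_real_inner_le_norm _ _).trans_eq ?_
  rw [norm_indicatorConstLp (by norm_num) (by norm_num), Measure.real,
    Measure.restrict_apply measurableSet_Ioo, hinter]
  simp [hx.1]

end L2

lemma primitive_congr_ae {a b : ℝ} {f g : ℝ → ℝ} (h : f =ᵐ[volume.restrict (Ioo a b)] g) {x : ℝ}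
    (hx : x ∈ Icc a b) : ∫ s in a..x, f s = ∫ s in a..x, g s := by
  simp only [intervalIntegral.integral_of_le hx.1, integral_Ioc_eq_integral_Ioo]
  exact integral_congr_ae (ae_restrict_of_ae_restrict_of_subset (Ioo_subset_Ioo_right hx.2) h)

namespace L2

lemma primitive_add (f g : L2) {x : ℝ} (hx : x ∈ Icc (0 : ℝ) 1) :
    ∫ s in (0 : ℝ)..x, (f + g : L2) s = (∫ s in (0 : ℝ)..x, f s) + ∫ s in (0 : ℝ)..x, g s := by
  rw [primitive_congr_ae (Lp.coeFn_add f g) hx]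
  exact intervalIntegral.integral_add (f.intervalIntegrable hx) (g.intervalIntegrable hx)

lemma primitive_smul (c : ℝ) (f : L2) {x : ℝ} (hx : x ∈ Icc (0 : ℝ) 1) :
    ∫ s in (0 : ℝ)..x, (c • f : L2) s = c * ∫ s in (0 : ℝ)..x, f s := by
  rw [primitive_congr_ae (Lp.coeFn_smul c f) hx]
  exact intervalIntegral.integral_const_mul c f

end L2

section Green

variable {α : ℝ}

lemma memLp_rpow {β : ℝ} (hβ : -1 / 2 < β) :
    MemLp (fun x : ℝ => x ^ β) 2 (volume.restrict (Ioo (0 : ℝ) 1)) := by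
  have hmeas : Measurable fun x : ℝ => x ^ β := measurable_id.pow_const β
  rw [memLp_two_iff_integrable_sq hmeas.aestronglyMeasurable]
  have hintegral := (intervalIntegrable_iff_integrableOn_Ioo_of_le zero_le_one).1
    (intervalIntegral.intervalIntegrable_rpow' (a := 0) (b := 1) (r := β * 2) (by linarith))
  refine (integrableOn_congr_fun (fun x hx => ?_) measurableSet_Ioo).1 hintegral
  exact_mod_cast Real.rpow_mul hx.1.le β 2

lemma norm_rpow_mul_primitive_le (f : L2) {x : ℝ} (hx : x ∈ Ioo (0 : ℝ) 1) :
    ‖x ^ (-(α / 2)) * ∫ s in (0 : ℝ)..x, f s‖ ≤ ‖f‖ * ‖x ^ ((1 - α) / 2)‖ := by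
  have hpos (β : ℝ) : 0 ≤ x ^ β := Real.rpow_nonneg hx.1.le β
  rw [norm_mul, Real.norm_of_nonneg (hpos _), Real.norm_of_nonneg (hpos _), Real.norm_eq_abs]
  calc x ^ (-(α / 2)) * |∫ s in (0 : ℝ)..x, f s|
      ≤ x ^ (-(α / 2)) * (x ^ (1 / 2 : ℝ) * ‖f‖) :=
        mul_le_mul_of_nonneg_left (f.abs_primitive_le (Ioo_subset_Icc_self hx)) (hpos _)
    _ = ‖f‖ * x ^ ((1 - α) / 2) := by
        rw [← mul_assoc, ← Real.rpow_add hx.1, mul_comm]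
        ring_nf

lemma memLp_rpow_mul_primitive (hα : α < 2) (f : L2) :
    MemLp (fun x : ℝ => x ^ (-(α / 2)) * ∫ s in (0 : ℝ)..x, f s) 2
      (volume.restrict (Ioo (0 : ℝ) 1)) := by
  refine .of_le_mul (memLp_rpow (β := (1 - α) / 2) (by linarith)) (c := ‖f‖) ?_ ?_
  · exact (measurable_id.pow_const _).aestronglyMeasurable.mul
      (((continuousOn_primitive f.integrableOn).mono Ioo_subset_Icc_self).aestronglyMeasurable
        measurableSet_Ioo)
  · filter_upwards [ae_restrict_mem measurableSet_Ioo] with x hx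
    exact norm_rpow_mul_primitive_le f hx

/-- The weighted Hardy operator `f ↦ x^(-α/2) ∫₀ˣ f` on `L²(0, 1)`; it is bounded since
`|∫₀ˣ f| ≤ x^(1/2) ‖f‖`. -/
noncomputable def hardy (α : ℝ) (hα : α < 2) : L2 →L[ℝ] L2 :=
  LinearMap.mkContinuous
    { toFun f := (memLp_rpow_mul_primitive hα f).toLp
      map_add' f g := by
        rw [← MemLp.toLp_add]
        refine MemLp.toLp_congr _ _ ?_
        filter_upwards [ae_restrict_mem measurableSet_Ioo] with x hx
        rw [Pi.add_apply, L2.primitive_add f g (Ioo_subset_Icc_self hx), mul_add]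
      map_smul' c f := by
        rw [RingHom.id_apply, ← MemLp.toLp_const_smul]
        refine MemLp.toLp_congr _ _ ?_
        filter_upwards [ae_restrict_mem measurableSet_Ioo] with x hx
        rw [Pi.smul_apply, smul_eq_mul, L2.primitive_smul c f (Ioo_subset_Icc_self hx),
          mul_left_comm] }
    ‖(memLp_rpow (β := (1 - α) / 2) (by linarith)).toLp‖ fun f => by
      rw [mul_comm]
      refine Lp.norm_le_mul_norm_of_ae_le_mul ?_
      filter_upwards [(memLp_rpow_mul_primitive hα f).coeFn_toLp,
        (memLp_rpow (β := (1 - α) / 2) (by linarith)).coeFn_toLp,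
        ae_restrict_mem measurableSet_Ioo] with x hf hpow hx
      simpa only [LinearMap.coe_mk, AddHom.coe_mk, hf, hpow] using norm_rpow_mul_primitive_le f hx

lemma hardy_ae_eq (hα : α < 2) (f : L2) : hardy α hα f
    =ᵐ[volume.restrict (Ioo (0 : ℝ) 1)] fun x => x ^ (-(α / 2)) * ∫ s in (0 : ℝ)..x, f s :=
  (memLp_rpow_mul_primitive hα f).coeFn_toLp

lemma hardy_injective (hα : α < 2) : Function.Injective (hardy α hα) := by
  refine (injective_iff_map_eq_zero _).2 fun f hf => ?_
  have hprim : (fun x => ∫ s in (0 : ℝ)..x, f s)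
      =ᵐ[volume.restrict (Ioo (0 : ℝ) 1)] fun _ => 0 := by
    filter_upwards [hardy_ae_eq hα f, (Lp.eq_zero_iff_ae_eq_zero).1 hf,
      ae_restrict_mem measurableSet_Ioo] with x hx h0 hx01
    exact (mul_eq_zero.1 (hx.symm.trans h0)).resolve_left (Real.rpow_pos_of_pos hx01.1 _).ne'
  have hderiv := (hasWeakDeriv_primitive f.integrableOn).congr_ae hprim .rfl
  have hzero := hasWeakDeriv_deriv (a := 0) (b := 1) (contDiff_const (c := (0 : ℝ)))
  rw [deriv_const'] at hzero
  exact Lp.eq_zero_iff_ae_eq_zero.2 (hderiv.ae_eq hzero)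

/-- The inverse of `-∂ₓ(x^α ∂ₓ)` with the boundary conditions `(x^α ∂ₓf)(0) = 0` and `f(1) = 0`:
composing `hardy` with its adjoint gives `f ↦ ∫ₓ¹ y^(-α) ∫₀ʸ f`. -/
noncomputable def green (α : ℝ) (hα : α < 2) : L2 →L[ℝ] L2 :=
  ContinuousLinearMap.adjoint (hardy α hα) ∘L hardy α hα

lemma inner_green (hα : α < 2) (f g : L2) :
    ⟪green α hα f, g⟫_ℝ = ⟪hardy α hα f, hardy α hα g⟫_ℝ := by
  rw [green, ContinuousLinearMap.comp_apply, ContinuousLinearMap.adjoint_inner_left]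

lemma isPositive_green (hα : α < 2) : (green α hα).IsPositive :=
  ContinuousLinearMap.isPositive_adjoint_comp_self _

lemma green_injective (hα : α < 2) : Function.Injective (green α hα) := by
  have hker := ContinuousLinearMap.ker_adjoint_comp_self (hardy α hα)
  rw [LinearMap.ker_eq_bot.2 (hardy_injective hα)] at hker
  exact LinearMap.ker_eq_bot.1 hker

end Green

section DegenerateOp

variable {α : ℝ}

/-- Multiplication by a function continuous on `[0, 1]`, as an operator on `L²(0, 1)`. -/
noncomputable def mulContinuousOn (χ : ℝ → ℝ) (hχ : ContinuousOn χ (Icc 0 1)) : L2 →L[ℝ] L2 :=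
  (ContinuousLinearMap.mul ℝ ℝ).holderL (volume.restrict (Ioo (0 : ℝ) 1)) ⊤ 2 2
    (memLp_of_continuousOn hχ ⊤).toLp

lemma mulContinuousOn_ae_eq {χ : ℝ → ℝ} (hχ : ContinuousOn χ (Icc 0 1)) (f : L2) :
    mulContinuousOn χ hχ f =ᵐ[volume.restrict (Ioo (0 : ℝ) 1)] fun x => χ x * f x := by
  filter_upwards [(ContinuousLinearMap.mul ℝ ℝ).coeFn_holder (r := 2)
    (memLp_of_continuousOn hχ ⊤).toLp f, (memLp_of_continuousOn hχ ⊤).coeFn_toLp] with x hx hχx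
  rw [mulContinuousOn, ContinuousLinearMap.holderL_apply_apply, hx, hχx,
    ContinuousLinearMap.mul_apply']

lemma continuousOn_rpow {β : ℝ} (hβ : 0 ≤ β) : ContinuousOn (fun x : ℝ => x ^ β) (Icc 0 1) :=
  (Real.continuous_rpow_const hβ).continuousOn

lemma contDiffOn_rpow (β : ℝ) : ContDiffOn ℝ ∞ (fun x : ℝ => x ^ β) (Ioo 0 1) := fun _ hx =>
  (Real.contDiffAt_rpow_const_of_ne hx.1.ne').contDiffWithinAt

/-- The degenerate operator `p ↦ ∂ₓ(x^α ∂ₓp) = α x^(α-1) p' + x^α p''` from `H²(0, 1)` to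
`L²(0, 1)`. -/
noncomputable def degenerateOp (α : ℝ) (hα : 1 ≤ α) : H2 →L[ℝ] L2 :=
  ((α • mulContinuousOn _ (continuousOn_rpow (sub_nonneg.2 hα))) ∘L .fst ℝ L2 L2 +
    mulContinuousOn _ (continuousOn_rpow (zero_le_one.trans hα)) ∘L .snd ℝ L2 L2) ∘L
      .snd ℝ L2 (L2 × L2) ∘L H2.subtypeL

lemma degenerateOp_ae_eq (hα : 1 ≤ α) (p : H2) :
    degenerateOp α hα p =ᵐ[volume.restrict (Ioo (0 : ℝ) 1)]
      fun x => α * x ^ (α - 1) * dx p x + x ^ α * p.1.2.2 x := by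
  have hfst := continuousOn_rpow (sub_nonneg.2 hα)
  have hsnd := continuousOn_rpow (zero_le_one.trans hα)
  have happly : degenerateOp α hα p
      = α • mulContinuousOn _ hfst (dx p) + mulContinuousOn _ hsnd p.1.2.2 := rfl
  rw [happly]
  filter_upwards [Lp.coeFn_add (α • mulContinuousOn _ hfst (dx p)) (mulContinuousOn _ hsnd p.1.2.2),
    Lp.coeFn_smul α (mulContinuousOn _ hfst (dx p)), mulContinuousOn_ae_eq hfst (dx p),
    mulContinuousOn_ae_eq hsnd p.1.2.2] with x hadd hsmul hx hx'
  rw [hadd, Pi.add_apply, hsmul, Pi.smul_apply, hx, hx', smul_eq_mul, mul_assoc]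

lemma hasWeakDeriv_flux (hα : 1 ≤ α) (p : H2) :
    HasWeakDeriv 0 1 (fun y => y ^ α * dx p y) (degenerateOp α hα p) := by
  have hdx : HasWeakDeriv 0 1 (dx p) p.1.2.2 := p.2.2
  refine (hdx.mul_left (contDiffOn_rpow α)).congr_ae .rfl ?_
  filter_upwards [degenerateOp_ae_eq hα p, ae_restrict_mem measurableSet_Ioo] with x hx hx01
  rw [hx, (Real.hasDerivAt_rpow_const (.inl hx01.1.ne')).deriv]

lemma integral_mul_add_weakDeriv (hα : 1 ≤ α) (f g : L2) (p : H2) :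
    ∫ x in Ioo (0 : ℝ) 1, f x * (g x + weakDeriv 0 1 (fun y => y ^ α * dx p y) x)
      = ⟪f, g + degenerateOp α hα p⟫_ℝ := by
  rw [L2.inner_eq]
  refine integral_congr_ae ?_
  filter_upwards [weakDeriv_ae_eq (hasWeakDeriv_flux hα p),
    Lp.coeFn_add g (degenerateOp α hα p)] with x hweak hadd
  rw [hweak, hadd, Pi.add_apply]

end DegenerateOp

section ContRep

variable {α : ℝ} {f g : ℝ → ℝ}

lemma ae_eq_contRep (hg : ContinuousOn g (Icc 0 1))
    (h : f =ᵐ[volume.restrict (Ioo (0 : ℝ) 1)] g) :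
    f =ᵐ[volume.restrict (Ioo (0 : ℝ) 1)] contRep f := by
  have hex : ∃ g : ℝ → ℝ, ContinuousOn g (Icc 0 1) ∧ f =ᵐ[volume.restrict (Ioo (0 : ℝ) 1)] g :=
    ⟨g, hg, h⟩
  rw [contRep, dif_pos hex]
  exact hex.choose_spec.2

lemma contRep_eqOn (hg : ContinuousOn g (Icc 0 1))
    (h : f =ᵐ[volume.restrict (Ioo (0 : ℝ) 1)] g) : EqOn (contRep f) g (Icc 0 1) := by
  have hex : ∃ g : ℝ → ℝ, ContinuousOn g (Icc 0 1) ∧ f =ᵐ[volume.restrict (Ioo (0 : ℝ) 1)] g :=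
    ⟨g, hg, h⟩
  have hae := (ae_eq_contRep hg h).symm.trans h
  rw [Measure.restrict_congr_set Ioo_ae_eq_Icc] at hae
  refine Measure.eqOn_Icc_of_ae_eq volume zero_ne_one hae ?_ hg
  rw [contRep, dif_pos hex]
  exact hex.choose_spec.1

namespace HasWeakDeriv

lemma contRep_eq_add_primitive (h : HasWeakDeriv 0 1 f g) (hg : IntegrableOn g (Ioo 0 1)) {x : ℝ}
    (hx : x ∈ Icc (0 : ℝ) 1) : contRep f x = contRep f 0 + ∫ s in (0 : ℝ)..x, g s := by
  obtain ⟨c, hc⟩ := h.exists_ae_eq_primitive zero_lt_one hg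
  have heq := contRep_eqOn (continuousOn_const.add (continuousOn_primitive hg)) hc
  have h0 : contRep f 0 = c := by simpa using heq (left_mem_Icc.2 zero_le_one)
  rw [h0]
  exact heq hx

lemma continuousOn_contRep (h : HasWeakDeriv 0 1 f g) (hg : IntegrableOn g (Ioo 0 1)) :
    ContinuousOn (contRep f) (Icc 0 1) :=
  (continuousOn_const.add (continuousOn_primitive hg)).congr fun _ hx =>
    h.contRep_eq_add_primitive hg hx

lemma ae_eq_contRep (h : HasWeakDeriv 0 1 f g) (hg : IntegrableOn g (Ioo 0 1)) :
    f =ᵐ[volume.restrict (Ioo (0 : ℝ) 1)] contRep f := by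
  obtain ⟨c, hc⟩ := h.exists_ae_eq_primitive zero_lt_one hg
  exact DegenerateParabolic.ae_eq_contRep (continuousOn_const.add (continuousOn_primitive hg)) hc

end HasWeakDeriv

lemma dx_ae_eq_contRep (p : H2) : dx p =ᵐ[volume.restrict (Ioo (0 : ℝ) 1)] contRep (dx p) :=
  p.2.2.ae_eq_contRep p.1.2.2.integrableOn

lemma rpow_mul_contRep_dx (hα : 1 ≤ α) (p : H2) {x : ℝ} (hx : x ∈ Icc (0 : ℝ) 1) :
    x ^ α * contRep (dx p) x = ∫ s in (0 : ℝ)..x, degenerateOp α hα p s := by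
  have hcont : ContinuousOn (contRep (dx p)) (Icc 0 1) :=
    p.2.2.continuousOn_contRep p.1.2.2.integrableOn
  have hflux {y : ℝ} (hy : y ∈ Icc (0 : ℝ) 1) :
      contRep (fun y => y ^ α * dx p y) y = y ^ α * contRep (dx p) y := by
    refine contRep_eqOn (g := fun y => y ^ α * contRep (dx p) y)
      ((continuousOn_rpow (zero_le_one.trans hα)).mul hcont) ?_ hy
    filter_upwards [dx_ae_eq_contRep p] with y hy
    rw [hy]
  have hzero : (0 : ℝ) ^ α = 0 := Real.zero_rpow (zero_lt_one.trans_le hα).ne'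
  rw [← hflux hx, (hasWeakDeriv_flux hα p).contRep_eq_add_primitive
    (degenerateOp α hα p).integrableOn hx, hflux (left_mem_Icc.2 zero_le_one), hzero, zero_mul,
    zero_add]

lemma tendsto_rpow_mul_contRep_dx (hα : 1 ≤ α) (p : H2) :
    Tendsto (fun x : ℝ => x ^ α * contRep (dx p) x) (𝓝[>] 0) (𝓝 0) := by
  have hcont : ContinuousOn (fun x : ℝ => x ^ α * contRep (dx p) x) (Icc 0 1) :=
    (continuousOn_primitive (degenerateOp α hα p).integrableOn).congr fun x hx =>
      rpow_mul_contRep_dx hα p hx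
  have htendsto := (hcont 0 (left_mem_Icc.2 zero_le_one)).tendsto
  rw [rpow_mul_contRep_dx hα p (left_mem_Icc.2 zero_le_one),
    intervalIntegral.integral_same] at htendsto
  refine htendsto.mono_left ?_
  rw [← nhdsWithin_Ioo_eq_nhdsGT zero_lt_one]
  exact nhdsWithin_mono _ Ioo_subset_Icc_self

/-- The constant function `1`, as an element of `L²(0, 1)`. -/
noncomputable def one : L2 := Lp.const 2 (volume.restrict (Ioo (0 : ℝ) 1)) (1 : ℝ)

lemma inner_one (f : L2) : ⟪one, f⟫_ℝ = ∫ s in (0 : ℝ)..1, f s := by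
  rw [L2.inner_eq, intervalIntegral.integral_of_le zero_le_one, integral_Ioc_eq_integral_Ioo]
  refine integral_congr_ae ?_
  filter_upwards [Lp.coeFn_const 2 (volume.restrict (Ioo (0 : ℝ) 1)) (1 : ℝ)] with x hx
  rw [one, hx, Function.const_apply, one_mul]

lemma inner_one_degenerateOp (hα : 1 ≤ α) (p : H2) :
    ⟪one, degenerateOp α hα p⟫_ℝ = contRep (dx p) 1 := by
  rw [inner_one, ← rpow_mul_contRep_dx hα p (right_mem_Icc.2 zero_le_one), Real.one_rpow, one_mul]

lemma toL2_ae_eq_primitive {p : H2} (hp : contRep (toL2 p) 1 = 0) :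
    toL2 p =ᵐ[volume.restrict (Ioo (0 : ℝ) 1)] fun x => ∫ s in (1 : ℝ)..x, dx p s := by
  have hprim {y : ℝ} (hy : y ∈ Icc (0 : ℝ) 1) :=
    p.2.1.contRep_eq_add_primitive (dx p).integrableOn hy
  filter_upwards [p.2.1.ae_eq_contRep (dx p).integrableOn,
    ae_restrict_mem measurableSet_Ioo] with x hx hx01
  have hx01 := Ioo_subset_Icc_self hx01
  have h1 : 0 = contRep (toL2 p) 0 + ∫ s in (0 : ℝ)..1, dx p s :=
    hp.symm.trans (hprim (right_mem_Icc.2 zero_le_one))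
  have hsplit := intervalIntegral.integral_interval_sub_left ((dx p).intervalIntegrable hx01)
    ((dx p).intervalIntegrable (right_mem_Icc.2 zero_le_one))
  calc toL2 p x = contRep (toL2 p) x := hx
    _ = contRep (toL2 p) 0 + ∫ s in (0 : ℝ)..x, dx p s := hprim hx01
    _ = ∫ s in (1 : ℝ)..x, dx p s := by rw [← hsplit]; linarith

lemma hardy_degenerateOp_mul_hardy (hα : 1 ≤ α) (hα' : α < 2) (p : H2) (f : L2) :
    (fun x => hardy α hα' (degenerateOp α hα p) x * hardy α hα' f x)
      =ᵐ[volume.restrict (Ioo (0 : ℝ) 1)] fun x => (∫ s in (0 : ℝ)..x, f s) * dx p x := by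
  filter_upwards [hardy_ae_eq hα' (degenerateOp α hα p), hardy_ae_eq hα' f, dx_ae_eq_contRep p,
    ae_restrict_mem measurableSet_Ioo] with x hxp hxf hdx hx
  have hpow : x ^ (-(α / 2)) * x ^ α * x ^ (-(α / 2)) = 1 := by
    rw [← Real.rpow_add hx.1, ← Real.rpow_add hx.1]
    ring_nf
    exact Real.rpow_zero _
  rw [hxp, hxf, hdx, ← rpow_mul_contRep_dx hα p (Ioo_subset_Icc_self hx)]
  linear_combination (contRep (dx p) x * ∫ s in (0 : ℝ)..x, f s) * hpow

lemma green_degenerateOp (hα : 1 ≤ α) (hα' : α < 2) {p : H2} (hp : contRep (toL2 p) 1 = 0) :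
    green α hα' (degenerateOp α hα p) = -toL2 p := by
  refine ext_inner_right ℝ fun f => ?_
  have h01 : (1 : ℝ) ∈ Icc (0 : ℝ) 1 := right_mem_Icc.2 zero_le_one
  calc ⟪green α hα' (degenerateOp α hα p), f⟫_ℝ
      = ∫ x in Ioo (0 : ℝ) 1, (∫ s in (0 : ℝ)..x, f s) * dx p x := by
        rw [inner_green, L2.inner_eq]
        exact integral_congr_ae (hardy_degenerateOp_mul_hardy hα hα' p f)
    _ = -∫ x in Ioo (0 : ℝ) 1, f x * ∫ s in (1 : ℝ)..x, dx p s := by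
        simp only [← integral_Ioc_eq_integral_Ioo,
          ← intervalIntegral.integral_of_le (zero_le_one (α := ℝ))]
        exact integral_primitive_mul (f.intervalIntegrable h01) ((dx p).intervalIntegrable h01)
    _ = ⟪-toL2 p, f⟫_ℝ := by
        rw [inner_neg_left, real_inner_comm, L2.inner_eq]
        refine congrArg Neg.neg (integral_congr_ae ?_)
        filter_upwards [toL2_ae_eq_primitive hp] with x hx
        rw [hx]

end ContRep

section Range

variable {α : ℝ} {P : ℝ → ℝ}

lemma hasWeakDeriv_toLp {f g : ℝ → ℝ} (h : HasWeakDeriv 0 1 f g)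
    (hf : MemLp f 2 (volume.restrict (Ioo (0 : ℝ) 1)))
    (hg : MemLp g 2 (volume.restrict (Ioo (0 : ℝ) 1))) :
    HasWeakDeriv 0 1 hf.toLp hg.toLp :=
  h.congr_ae hf.coeFn_toLp.symm hg.coeFn_toLp.symm

/-- The restriction to `(0, 1)` of a `C²` function, as an element of `H²(0, 1)`. -/
noncomputable def H2.ofContDiff (P : ℝ → ℝ) (hP : ContDiff ℝ 2 P) : H2 :=
  have hP' : ContDiff ℝ 1 (deriv P) := hP.iterate_deriv' 1 1
  have hmem := memLp_of_continuousOn (a := 0) (b := 1) hP.continuous.continuousOn 2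
  have hmem' := memLp_of_continuousOn (a := 0) (b := 1) hP'.continuous.continuousOn 2
  have hmem'' := memLp_of_continuousOn (a := 0) (b := 1)
    (hP'.continuous_deriv le_rfl).continuousOn 2
  ⟨(hmem.toLp, hmem'.toLp, hmem''.toLp),
    hasWeakDeriv_toLp (hasWeakDeriv_deriv (hP.of_le one_le_two)) hmem hmem',
    hasWeakDeriv_toLp (hasWeakDeriv_deriv hP') hmem' hmem''⟩

lemma contRep_toL2_ofContDiff (hP : ContDiff ℝ 2 P) :
    EqOn (contRep (toL2 (H2.ofContDiff P hP))) P (Icc 0 1) :=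
  contRep_eqOn hP.continuous.continuousOn
    (memLp_of_continuousOn hP.continuous.continuousOn 2).coeFn_toLp

lemma dx_ofContDiff_ae_eq (hP : ContDiff ℝ 2 P) :
    dx (H2.ofContDiff P hP) =ᵐ[volume.restrict (Ioo (0 : ℝ) 1)] deriv P :=
  (memLp_of_continuousOn (hP.continuous_deriv one_le_two).continuousOn 2).coeFn_toLp

lemma exists_degenerateOp_ae_eq_deriv (hα : 1 ≤ α) {θ : ℝ → ℝ} (hθ : MemCcInfty 0 1 θ) :
    ∃ p : H2, contRep (toL2 p) 1 = 0 ∧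
      degenerateOp α hα p =ᵐ[volume.restrict (Ioo (0 : ℝ) 1)] deriv θ := by
  have hq := (hθ.mul_left (contDiffOn_rpow (-α))).contDiff
  have hP := (contDiff_primitive hq 1).of_le (m := 2) (by norm_cast)
  refine ⟨H2.ofContDiff _ hP, ?_, ?_⟩
  · rw [contRep_toL2_ofContDiff hP (right_mem_Icc.2 zero_le_one)]
    exact intervalIntegral.integral_same
  · refine ((hasWeakDeriv_flux hα _).congr_ae ?_ .rfl).ae_eq
      (hasWeakDeriv_deriv (hθ.contDiff.of_le (mod_cast le_top)))
    filter_upwards [dx_ofContDiff_ae_eq hP, ae_restrict_mem measurableSet_Ioo] with x hx hx01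
    rw [hx, deriv_primitive hq.continuous, ← mul_assoc, ← Real.rpow_add hx01.1, add_neg_cancel,
      Real.rpow_zero, one_mul]

lemma exists_contRep_dx_eq_one :
    ∃ p : H2, contRep (toL2 p) 1 = 0 ∧ contRep (dx p) 1 = 1 := by
  have hP : ContDiff ℝ 2 fun x : ℝ => x - 1 := contDiff_id.sub contDiff_const
  have h01 : (1 : ℝ) ∈ Icc (0 : ℝ) 1 := right_mem_Icc.2 zero_le_one
  refine ⟨H2.ofContDiff _ hP, ?_, ?_⟩
  · rw [contRep_toL2_ofContDiff hP h01]
    exact sub_self 1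
  · rw [contRep_eqOn (hP.continuous_deriv one_le_two).continuousOn (dx_ofContDiff_ae_eq hP) h01]
    simp

-- Testing against `θ'` shows that `w` is constant, and testing against `x - 1` that it is zero.
lemma eq_zero_of_inner_degenerateOp_eq_zero (hα : 1 ≤ α) {w : L2}
    (h : ∀ p : H2, contRep (toL2 p) 1 = 0 → ⟪w, degenerateOp α hα p⟫_ℝ = 0) : w = 0 := by
  have hderiv : HasWeakDeriv 0 1 w 0 := by
    refine ⟨L2.locallyIntegrableOn w, locallyIntegrableOn_zero, fun θ hθ hc hs => ?_⟩
    obtain ⟨p, hp, hpθ⟩ := exists_degenerateOp_ae_eq_deriv hα ⟨hθ, hc, hs⟩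
    calc ∫ x in Ioo (0 : ℝ) 1, w x * deriv θ x = ⟪w, degenerateOp α hα p⟫_ℝ := by
          rw [L2.inner_eq]
          refine integral_congr_ae ?_
          filter_upwards [hpθ] with x hx
          rw [hx]
      _ = -∫ x in Ioo (0 : ℝ) 1, (0 : ℝ → ℝ) x * θ x := by simp [h p hp]
  obtain ⟨c, hc⟩ := hderiv.exists_ae_eq_const zero_lt_one
  have hw : w = c • one := by
    refine Lp.ext ?_
    filter_upwards [hc, Lp.coeFn_smul c one,
      Lp.coeFn_const 2 (volume.restrict (Ioo (0 : ℝ) 1)) (1 : ℝ)] with x hx hsmul hone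
    rw [hx, hsmul, Pi.smul_apply, one, hone, Function.const_apply, smul_eq_mul, mul_one]
  obtain ⟨p, hp, hp1⟩ := exists_contRep_dx_eq_one
  have hc0 : c = 0 := by
    simpa only [hw, real_inner_smul_left, inner_one_degenerateOp, hp1, mul_one] using h p hp
  rw [hw, hc0, zero_smul]

end Range

lemma intervalIntegral_inner {H : Type*} [NormedAddCommGroup H] [InnerProductSpace ℝ H]
    [CompleteSpace H] {a b : ℝ} {f : ℝ → H} (hf : IntervalIntegrable f volume a b) (y : H) :
    ⟪∫ t in a..b, f t, y⟫_ℝ = ∫ t in a..b, ⟪f t, y⟫_ℝ := by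
  rw [real_inner_comm, ← innerSL_apply_apply ℝ, ← (innerSL ℝ y).intervalIntegral_comp_comm hf]
  simp only [innerSL_apply_apply, real_inner_comm]

section WeakSolution

variable {α τ T : ℝ} {f₀ : L2} {u v : ℝ → ℝ} {f : ℝ → L2}

lemma isTestFunction_const (hα : 1 ≤ α) {p : H2} (hp : contRep (toL2 p) 1 = 0) :
    IsTestFunction α τ fun _ => p where
  contDiffOn := contDiffOn_const
  continuousOn := continuousOn_const
  flux_zero _ _ := tendsto_rpow_mul_contRep_dx hα p
  eq_zero _ _ := hp

lemma isWeakSolution_iff_inner (hα : 1 ≤ α) :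
    IsWeakSolution α T f₀ u f ↔ ContinuousOn f (Icc 0 T) ∧
      ∀ τ ∈ Icc 0 T, ∀ ψ : ℝ → H2, IsTestFunction α τ ψ →
        ∫ t in (0 : ℝ)..τ,
            ⟪f t, derivWithin (fun s => toL2 (ψ s)) (Icc 0 τ) t + degenerateOp α hα (ψ t)⟫_ℝ
          = ⟪f τ, toL2 (ψ τ)⟫_ℝ - ⟪f₀, toL2 (ψ 0)⟫_ℝ
            + ∫ t in (0 : ℝ)..τ, u t * ⟪one, degenerateOp α hα (ψ t)⟫_ℝ := by
  simp only [← integral_mul_add_weakDeriv, inner_one_degenerateOp]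
  simp only [L2.inner_eq]
  exact ⟨fun h => ⟨h.continuousOn, h.integral_identity⟩, fun h => ⟨h.1, h.2⟩⟩

lemma IsWeakSolution.isMildSolution (hα : 1 ≤ α) (hα' : α < 2) (hu : ContinuousOn u (Icc 0 T))
    (hf : IsWeakSolution α T f₀ u f) :
    IsMildSolution (green α hα') T f₀ (fun t => u t • one) f := by
  obtain ⟨hcont, hweak⟩ := (isWeakSolution_iff_inner hα).1 hf
  refine ⟨hcont, fun τ hτ => sub_eq_zero.1 (eq_zero_of_inner_degenerateOp_eq_zero hα
    fun p hp => ?_)⟩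
  have hcont' := hcont.mono (Icc_subset_Icc_right hτ.2)
  have hu' := hu.mono (Icc_subset_Icc_right hτ.2)
  have hgreen (k : L2) : ⟪green α hα' k, degenerateOp α hα p⟫_ℝ = -⟪k, toL2 p⟫_ℝ := by
    rw [← inner_neg_right, ← green_degenerateOp hα hα' hp]
    exact (isPositive_green hα').isSymmetric k _
  have hintegral : ⟪∫ s in (0 : ℝ)..τ, (u s • one - f s), degenerateOp α hα p⟫_ℝ
      = (∫ s in (0 : ℝ)..τ, u s * ⟪one, degenerateOp α hα p⟫_ℝ)
        - ∫ s in (0 : ℝ)..τ, ⟪f s, degenerateOp α hα p⟫_ℝ := by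
    have hsub : IntervalIntegrable (fun s => u s • one - f s) volume 0 τ :=
      ((hu'.smul continuousOn_const).sub hcont').intervalIntegrable_of_Icc hτ.1
    simp only [intervalIntegral_inner hsub, inner_sub_left, real_inner_smul_left]
    exact intervalIntegral.integral_sub
      ((hu'.mul continuousOn_const).intervalIntegrable_of_Icc hτ.1)
      ((hcont'.inner continuousOn_const).intervalIntegrable_of_Icc hτ.1)
  have hconst := hweak τ hτ _ (isTestFunction_const hα hp)
  simp only [derivWithin_fun_const, Pi.zero_apply, zero_add] at hconst
  rw [inner_sub_left, inner_add_left, hintegral, hgreen, hgreen, hconst]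
  ring

lemma IsMildSolution.isWeakSolution (hα : 1 ≤ α) (hα' : α < 2) (hT : 0 ≤ T)
    (hu : ContinuousOn u (Icc 0 T))
    (hf : IsMildSolution (green α hα') T f₀ (fun t => u t • one) f) :
    IsWeakSolution α T f₀ u f := by
  refine (isWeakSolution_iff_inner hα).2 ⟨hf.continuousOn, fun τ hτ ψ hψ => ?_⟩
  rw [← hf.apply_zero (green_injective hα') hT]
  rcases hτ.1.eq_or_lt with rfl | hτ0
  · simp
  have hcont := hf.continuousOn.mono (Icc_subset_Icc_right hτ.2)
  have hu' := hu.mono (Icc_subset_Icc_right hτ.2)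
  have hD : ContinuousOn (fun t => degenerateOp α hα (ψ t)) (Icc 0 τ) :=
    (degenerateOp α hα).continuous.comp_continuousOn hψ.continuousOn
  have hgreen : EqOn (fun t => green α hα' (-degenerateOp α hα (ψ t))) (fun t => toL2 (ψ t))
      (Icc 0 τ) := fun t ht => by
    simp only [map_neg, green_degenerateOp hα hα' (hψ.eq_zero t ht), neg_neg]
  have hKg := hψ.contDiffOn.congr hgreen
  have hKg' := hKg.continuousOn_derivWithin (uniqueDiffOn_Icc hτ0) le_rfl
  have hparts := hf.integral_inner_eq (isPositive_green hα').isSymmetric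
    (hu.smul continuousOn_const) hτ hD.neg hKg
  have h0 := hgreen (left_mem_Icc.2 hτ.1)
  have h1 := hgreen (right_mem_Icc.2 hτ.1)
  simp only [Pi.neg_apply] at hparts h0 h1
  rw [h0, h1] at hparts
  rw [← hparts, ← intervalIntegral.integral_add]
  · refine intervalIntegral.integral_congr fun t ht => ?_
    rw [uIcc_of_le hτ.1] at ht
    simp only [derivWithin_congr hgreen (hgreen ht)]
    simp only [inner_neg_right, inner_sub_left, real_inner_smul_left, inner_add_right]
    ring
  · exact ((hcont.inner hKg').add (((hu'.smul continuousOn_const).sub hcont).inner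
      hD.neg)).intervalIntegrable_of_Icc hτ.1
  · exact (hu'.mul (continuousOn_const.inner hD)).intervalIntegrable_of_Icc hτ.1

lemma IsWeakSolution.congr_ae (huv : u =ᵐ[volume.restrict (Ioo 0 T)] v)
    (hf : IsWeakSolution α T f₀ u f) : IsWeakSolution α T f₀ v f where
  continuousOn := hf.continuousOn
  integral_identity τ hτ ψ hψ := by
    rw [hf.integral_identity τ hτ ψ hψ]
    simp only [intervalIntegral.integral_of_le hτ.1, integral_Ioc_eq_integral_Ioo]
    congr 1
    refine integral_congr_ae ?_
    filter_upwards [ae_restrict_of_ae_restrict_of_subset (Ioo_subset_Ioo_right hτ.2) huv] with t ht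
    rw [ht]

end WeakSolution

end DegenerateParabolic

theorem mainTheorem5_general (α : ℝ) (hα : α ∈ Set.Ico (1 : ℝ) 2) (T : ℝ) (hT : 0 < T)
    (f₀ : DegenerateParabolic.L2) (u u' : ℝ → ℝ) (hu : DegenerateParabolic.HasWeakDeriv 0 T u u')
    (hu' : IntegrableOn u' (Ioo 0 T)) :
    (∃ f : ℝ → DegenerateParabolic.L2, DegenerateParabolic.IsWeakSolution α T f₀ u f) ∧
      ∀ f g : ℝ → DegenerateParabolic.L2,
        DegenerateParabolic.IsWeakSolution α T f₀ u f →
        DegenerateParabolic.IsWeakSolution α T f₀ u g → Set.EqOn f g (Set.Icc 0 T) := by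
  obtain ⟨c, hc⟩ := hu.exists_ae_eq_primitive hT hu'
  have hcont := (continuousOn_const (c := c)).add (DegenerateParabolic.continuousOn_primitive hu')
  have hpos := DegenerateParabolic.isPositive_green hα.2
  have hinj := DegenerateParabolic.green_injective hα.2
  refine ⟨?_, fun f g hf hg => ?_⟩
  · obtain ⟨f, hf⟩ := DegenerateParabolic.exists_isMildSolution hpos hinj hT.le f₀
      DegenerateParabolic.one c (hu'.congr_set_ae Ioo_ae_eq_Ioc.symm)
    exact ⟨f, (hf.isWeakSolution hα.1 hα.2 hT.le hcont).congr_ae hc.symm⟩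
  · exact DegenerateParabolic.IsMildSolution.eqOn hpos hinj
      ((hcont.smul continuousOn_const).intervalIntegrable_of_Icc hT.le)
      ((hf.congr_ae hc).isMildSolution hα.1 hα.2 hcont)
      ((hg.congr_ae hc).isMildSolution hα.1 hα.2 hcont)

theorem mainTheorem5 (α : ℝ) (hα : α ∈ Set.Ico (1 : ℝ) 2) (T : ℝ) (hT : 0 < T)
    (f₀ : DegenerateParabolic.L2) (u : ℝ → ℝ) (hu : DegenerateParabolic.MemH1 0 T u) :
    (∃ f : ℝ → DegenerateParabolic.L2, DegenerateParabolic.IsWeakSolution α T f₀ u f) ∧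
      ∀ f g : ℝ → DegenerateParabolic.L2,
        DegenerateParabolic.IsWeakSolution α T f₀ u f →
        DegenerateParabolic.IsWeakSolution α T f₀ u g → Set.EqOn f g (Set.Icc 0 T) := by
  obtain ⟨-, u', hu', huu'⟩ := hu
  exact mainTheorem5_general α hα T hT f₀ u u' huu' (hu'.integrable one_le_two)
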